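/- Let $k$ be a field of characteristic $0$, let $V$ be a $k$-vector space of finite dimension $n\ge 2$, let $N$ be an integer with $2\le N\le n$, and let $f\in V^{\otimes N}$ be a nonzero antisymmetric tensor, i.e. $\sigma\cdot f=\operatorname{sgn}(\sigma)f$ for all $\sigma\in S_N$. Put $R=kf\subseteq V^{\otimes N}$ and $A=A(V,R)=T(V)/I(R)$, where $I(R)$ is the two-sided ideal of the tensor algebra $T(V)$ generated by $R$. For $m\ge 0$ let $$W_m=\bigcap_{i+N+j=m}V^{\otimes i}\otimes R\otimes V^{\otimes j}\subseteq V^{\otimes m}$$ (so $W_m=V^{\otimes m}$ for $m<N$), and let $\nu_N(2i)=Ni$, $\nu_N(2i+1)=Ni+1$ for $i\ge 0$. The Koszul complex $K(A)$ of left $A$-modules has terms $K_i=A\otimes W_{\nu_N(i)}$ for $i\ge 0$, and its $A$-linear differentials $\delta_i:K_i\to K_{i-1}$, $i\ge 1$, are defined by the inclusion of $W_{\nu_N(i)}$ into $V^{\otimes(\nu_N(i)-\nu_N(i-1))}\otimes W_{\nu_N(i-1)}$ followed by the projection of the first tensor factor to $A$ and multiplication in $A$. Then: 1. $A$ is $N$-Koszul,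 i.e. the homology of $K(A)$ is $0$ in every degree $i>0$; 2. the global dimension of $A$ (the supremum of the projective dimensions of all left $A$-modules) is $2$; 3. $(R\otimes V^{\otimes m})\cap(V^{\otimes m}\otimes R)=0$ in $V^{\otimes(N+m)}$ for all $1\le m\le N-1$. -/

import Mathlib

open scoped TensorProduct

noncomputable section

universe u v w

namespace NKoszul

section TensorAlgebra

variable (k : Type u) [Field k] (V : Type v) [AddCommGroup V] [Module k V]

/-- The subspace `V^{⊗ m}` of the tensor algebra `T(V)`. Products of subspaces of `T(V)` play the
role of tensor products, e.g. `V^{⊗ i} ⊗ V^{⊗ j}` is `tpow k V i * tpow k V j`; see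
`linearDisjoint_tpow`. -/
def tpow (m : ℕ) : Submodule k (TensorAlgebra k V) :=
  LinearMap.range (TensorAlgebra.ι k : V →ₗ[k] TensorAlgebra k V) ^ m

theorem toTensorAlgebra_injective (m : ℕ) :
    Function.Injective (TensorPower.toTensorAlgebra : (⨂[k]^m) V →ₗ[k] TensorAlgebra k V) := by
  have h : ∀ x : (⨂[k]^m) V, TensorAlgebra.equivDirectSum (TensorPower.toTensorAlgebra x) =
      DirectSum.of (fun n => (⨂[k]^n) V) m x := by
    intro x
    have h1 : TensorAlgebra.ofDirectSum (DirectSum.of (fun n => (⨂[k]^n) V) m x) =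
        TensorPower.toTensorAlgebra x :=
      DirectSum.toAddMonoid_of
        (fun _ => LinearMap.toAddMonoidHom TensorPower.toTensorAlgebra) _ _
    rw [← h1]
    exact DFunLike.congr_fun (TensorAlgebra.toDirectSum_comp_ofDirectSum (R := k) (M := V)) _
  intro x y hxy
  have := congrArg TensorAlgebra.equivDirectSum hxy
  rw [h, h] at this
  exact DirectSum.of_injective m this

theorem toTensorAlgebra_mulEquiv {i j : ℕ} (a : (⨂[k]^i) V) (b : (⨂[k]^j) V) :
    TensorPower.toTensorAlgebra (TensorPower.mulEquiv (a ⊗ₜ[k] b)) =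
      TensorPower.toTensorAlgebra a * TensorPower.toTensorAlgebra b :=
  TensorPower.toTensorAlgebra_gMul a b

theorem range_toTensorAlgebra (m : ℕ) :
    LinearMap.range (TensorPower.toTensorAlgebra : (⨂[k]^m) V →ₗ[k] TensorAlgebra k V) =
      tpow k V m := by
  apply le_antisymm
  · rintro _ ⟨x, rfl⟩
    induction x using PiTensorProduct.induction_on with
    | smul_tprod r f =>
      rw [map_smul, TensorPower.toTensorAlgebra_tprod, TensorAlgebra.tprod_apply]
      refine Submodule.smul_mem _ _ ?_
      exact Submodule.pow_subset_pow _ (by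
        rw [Set.mem_pow]
        exact ⟨fun i => ⟨TensorAlgebra.ι k (f i), ⟨f i, rfl⟩⟩, rfl⟩)
    | add x y hx hy => rw [map_add]; exact Submodule.add_mem _ hx hy
  · induction m with
    | zero =>
      rw [tpow, pow_zero, Submodule.one_le]
      exact ⟨PiTensorProduct.tprod k (fun i => i.elim0), by simp⟩
    | succ m ih =>
      rw [tpow, pow_succ, Submodule.mul_le]
      rintro x hx _ ⟨v, rfl⟩
      obtain ⟨y, rfl⟩ := ih hx
      refine ⟨TensorPower.mulEquiv (y ⊗ₜ[k] PiTensorProduct.tprod k (fun _ : Fin 1 => v)), ?_⟩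
      rw [toTensorAlgebra_mulEquiv]
      simp

/-- The multiplication `V^{⊗ i} ⊗ V^{⊗ j} → T(V)` is injective. -/
theorem linearDisjoint_tpow (i j : ℕ) : (tpow k V i).LinearDisjoint (tpow k V j) := by
  rw [← range_toTensorAlgebra, ← range_toTensorAlgebra]
  constructor
  let ei := LinearEquiv.ofInjective _ (toTensorAlgebra_injective k V i)
  let ej := LinearEquiv.ofInjective _ (toTensorAlgebra_injective k V j)
  have h : Submodule.mulMap _ _ ∘ₗ (TensorProduct.congr ei ej).toLinearMap =
      TensorPower.toTensorAlgebra ∘ₗ TensorPower.mulEquiv.toLinearMap := by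
    refine TensorProduct.ext' fun a b => ?_
    simp only [LinearMap.comp_apply, LinearEquiv.coe_coe, toTensorAlgebra_mulEquiv,
      TensorProduct.congr_tmul, Submodule.mulMap_tmul]
    rfl
  have h2 : Function.Injective (TensorPower.toTensorAlgebra ∘ₗ
      (TensorPower.mulEquiv : (⨂[k]^i) V ⊗[k] (⨂[k]^j) V ≃ₗ[k] (⨂[k]^(i + j)) V).toLinearMap) :=
    (toTensorAlgebra_injective k V (i + j)).comp (LinearEquiv.injective _)
  rw [← h] at h2
  exact (Function.Injective.of_comp_iff' _ (TensorProduct.congr ei ej).bijective).1 h2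

end TensorAlgebra

section Homogeneous

variable {k : Type u} [Field k] {V : Type v} [AddCommGroup V] [Module k V] {N : ℕ}

/-- A tensor `f` of degree `N` is antisymmetric if `σ · f = sgn(σ) f` for all `σ ∈ S_N`. -/
def IsAntisymmetric (f : (⨂[k]^N) V) : Prop :=
  ∀ σ : Equiv.Perm (Fin N),
    PiTensorProduct.reindex k (fun _ : Fin N => V) σ f = ((Equiv.Perm.sign σ : ℤ) : k) • f

/-- The space of relations `R ⊆ V^{⊗ N}`, viewed inside the tensor algebra. -/
def rel (R : Submodule k ((⨂[k]^N) V)) : Submodule k (TensorAlgebra k V) :=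
  R.map TensorPower.toTensorAlgebra

/-- The two-sided ideal `I(R)` of `T(V)` generated by `R`. -/
def relIdeal (R : Submodule k ((⨂[k]^N) V)) : Ideal (TensorAlgebra k V) :=
  (TwoSidedIdeal.span (rel R : Set (TensorAlgebra k V))).asIdeal

instance (R : Submodule k ((⨂[k]^N) V)) : (relIdeal R).IsTwoSided := by
  unfold relIdeal; infer_instance

/-- The `N`-homogeneous algebra `A(V, R) = T(V) / I(R)`. -/
def Alg (R : Submodule k ((⨂[k]^N) V)) : Type (max u v) :=
  TensorAlgebra k V ⧸ relIdeal R

instance (R : Submodule k ((⨂[k]^N) V)) : Ring (Alg R) :=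
  inferInstanceAs (Ring (TensorAlgebra k V ⧸ relIdeal R))

instance (R : Submodule k ((⨂[k]^N) V)) : Algebra k (Alg R) :=
  inferInstanceAs (Algebra k (TensorAlgebra k V ⧸ relIdeal R))

/-- The quotient map `T(V) → A(V, R)`. -/
def Alg.mk (R : Submodule k ((⨂[k]^N) V)) : TensorAlgebra k V →ₐ[k] Alg R :=
  Ideal.Quotient.mkₐ k (relIdeal R)

/-- `W_m = ⋂_{i + N + j = m} V^{⊗ i} ⊗ R ⊗ V^{⊗ j} ⊆ V^{⊗ m}` (all of `V^{⊗ m}` if `m < N`). -/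
def W (R : Submodule k ((⨂[k]^N) V)) (m : ℕ) : Submodule k (TensorAlgebra k V) :=
  tpow k V m ⊓ ⨅ (i : ℕ) (j : ℕ) (_ : i + N + j = m), tpow k V i * rel R * tpow k V j

theorem linearDisjoint_W (R : Submodule k ((⨂[k]^N) V)) (d m : ℕ) :
    (tpow k V d).LinearDisjoint (W R m) :=
  (linearDisjoint_tpow k V d m).of_le_right_of_flat inf_le_left

theorem rel_le (R : Submodule k ((⨂[k]^N) V)) : rel R ≤ tpow k V N := by
  rw [← range_toTensorAlgebra]
  exact LinearMap.map_le_range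

/-- `W_q ⊆ V^{⊗ (q - p)} ⊗ W_p` for `p ≤ q`. -/
theorem W_le (R : Submodule k ((⨂[k]^N) V)) {p q : ℕ} (h : p ≤ q) :
    W R q ≤ tpow k V (q - p) * W R p := by
  obtain ⟨d, rfl⟩ := Nat.exists_eq_add_of_le' h
  rw [Nat.add_sub_cancel]
  let b := Module.Basis.ofVectorSpace k (tpow k V d)
  have key : ∀ S : Submodule k (TensorAlgebra k V), ∀ x ∈ tpow k V d * S,
      ∃ c : _ →₀ S, (c.sum fun i s => (b i : TensorAlgebra k V) * s) = x := by
    intro S x hx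
    rw [← Submodule.mulMap_range] at hx
    obtain ⟨t, rfl⟩ := hx
    obtain ⟨c, rfl⟩ := TensorProduct.eq_repr_basis_left b t
    exact ⟨c, by simp [Finsupp.sum, map_sum]⟩
  have inj : ∀ c c' : _ →₀ tpow k V p,
      (c.sum fun i s => (b i : TensorAlgebra k V) * s) =
        (c'.sum fun i s => (b i : TensorAlgebra k V) * s) → c = c' := by
    intro c c' hcc
    have := (linearDisjoint_tpow k V d p).linearIndependent_left_of_flat b.linearIndependent
    exact LinearMap.ker_eq_bot.1 this (by simpa [Submodule.mulLeftMap_apply] using hcc)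
  rintro x ⟨hx, hx'⟩
  have hx : x ∈ tpow k V d * tpow k V p := by
    simpa [tpow, pow_add] using hx
  obtain ⟨c, rfl⟩ := key _ _ hx
  refine Submodule.sum_mem _ fun i _ => Submodule.mul_mem_mul (b i).2 ⟨(c i).2, ?_⟩
  simp only [SetLike.mem_coe, Submodule.mem_iInf] at hx' ⊢
  intro i' j hij
  have hS : tpow k V i' * rel R * tpow k V j ≤ tpow k V p := by
    rw [← hij, tpow, tpow, tpow, pow_add, pow_add]
    exact mul_le_mul' (mul_le_mul' le_rfl (rel_le R)) le_rfl
  have h1 := hx' (d + i') j (by omega)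
  rw [show tpow k V (d + i') = tpow k V d * tpow k V i' from pow_add _ _ _, mul_assoc, mul_assoc,
    ← mul_assoc (tpow k V i')] at h1
  obtain ⟨c', hc'⟩ := key _ _ h1
  have : c = c'.mapRange (Submodule.inclusion hS) (map_zero _) := by
    apply inj
    rw [← hc', Finsupp.sum_mapRange_index (by simp)]
    rfl
  rw [this]
  exact (c' i).2

/-- The degrees `ν_N(2i) = N i`, `ν_N(2i + 1) = N i + 1`. -/
def nu (N i : ℕ) : ℕ := N * (i / 2) + i % 2

theorem nu_le_succ (hN : 2 ≤ N) (i : ℕ) : nu N i ≤ nu N (i + 1) := by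
  unfold nu
  rcases Nat.even_or_odd' i with ⟨c, rfl | rfl⟩
  · rw [show (2 * c + 1) / 2 = c by omega, show 2 * c / 2 = c by omega]
    omega
  · rw [show (2 * c + 1 + 1) / 2 = c + 1 by omega, show (2 * c + 1) / 2 = c by omega, mul_add]
    omega

/-- The inclusion of `W_q` into `V^{⊗ (q - p)} ⊗ W_p` for `p ≤ q`. -/
def inclW (R : Submodule k ((⨂[k]^N) V)) {p q : ℕ} (h : p ≤ q) :
    W R q →ₗ[k] tpow k V (q - p) ⊗[k] W R p :=
  (linearDisjoint_W R (q - p) p).mulMap.symm.toLinearMap ∘ₗ Submodule.inclusion (W_le R h)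

theorem inclW_apply (R : Submodule k ((⨂[k]^N) V)) {p q : ℕ} (hpq : p ≤ q)
    (u : tpow k V (q - p)) (w : W R p) (h : (u : TensorAlgebra k V) * w ∈ W R q) :
    inclW R hpq ⟨u * w, h⟩ = u ⊗ₜ w := by
  unfold inclW
  rw [LinearMap.comp_apply, LinearEquiv.coe_coe, LinearEquiv.symm_apply_eq]
  apply Subtype.ext
  rw [Submodule.LinearDisjoint.val_mulMap_tmul, Submodule.coe_inclusion]

/-- The term `K_i = A ⊗ W_{ν_N(i)}` of the Koszul complex, a left `A`-module. -/
abbrev K (R : Submodule k ((⨂[k]^N) V)) (i : ℕ) : Type (max u v) :=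
  Alg R ⊗[k] W R (nu N i)

/-- The left `A`-linear differential `K_{i+1} → K_i` of the Koszul complex: it sends `a ⊗ w` to
`∑ a \bar{u} ⊗ w'`, if `w = ∑ u ⊗ w'` in `V^{⊗ (ν_N(i+1) - ν_N(i))} ⊗ W_{ν_N(i)}`. -/
def differential (R : Submodule k ((⨂[k]^N) V)) (hN : 2 ≤ N) (i : ℕ) :
    K R (i + 1) →ₗ[Alg R] K R i :=
  TensorProduct.AlgebraTensorModule.lift <| LinearMap.toSpanSingleton (Alg R) _ <|
    ((Alg.mk R).toLinearMap ∘ₗ (tpow k V _).subtype).rTensor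
      (W R (nu N i)) ∘ₗ inclW R (nu_le_succ hN i)

theorem differential_apply (R : Submodule k ((⨂[k]^N) V)) (hN : 2 ≤ N) (i : ℕ) (a : Alg R)
    (u : tpow k V (nu N (i + 1) - nu N i)) (w : W R (nu N i))
    (h : (u : TensorAlgebra k V) * w ∈ W R (nu N (i + 1))) :
    differential R hN i (a ⊗ₜ ⟨u * w, h⟩) = (a * Alg.mk R (u : TensorAlgebra k V)) ⊗ₜ w := by
  unfold differential
  rw [TensorProduct.AlgebraTensorModule.lift_tmul, LinearMap.toSpanSingleton_apply,
    LinearMap.smul_apply, LinearMap.comp_apply, inclW_apply, LinearMap.rTensor_tmul,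
    TensorProduct.smul_tmul']
  rfl

/-- `A(V, R)` is `N`-Koszul: the homology of the Koszul complex vanishes in every degree `> 0`. -/
def IsNKoszul (R : Submodule k ((⨂[k]^N) V)) (hN : 2 ≤ N) : Prop :=
  ∀ i : ℕ, Function.Exact (differential R hN (i + 1)) (differential R hN i)

end Homogeneous

/-- The (left) global dimension of a ring: the supremum of the projective dimensions of all its
left modules. -/
def globalDimension (A : Type w) [Ring A] : WithBot ℕ∞ :=
  ⨆ M : ModuleCat.{w} A, CategoryTheory.projectiveDimension M

end NKoszul

end

/-! Fix a basis of `V` and order the words in its letters by length, then lexicographically.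
Exchanging two equal letters fixes a word but changes the sign of an antisymmetric tensor, so in
characteristic `0` the words occurring in `f` have no repeated letters. In particular the leading
word `s` of `f` does not overlap with itself, and everything follows from this property of `s`.

Without overlaps there are no ambiguities to resolve: `{f}` is a Gröbner basis of `I(R)`, that is,
the leading word of each nonzero element of the ideal contains `s`
(`exists_hasLead_of_mem_relIdeal`). The words avoiding `s` therefore span `A`, and a functional on
`A` can separate such a word from all smaller ones.

For each `A`-module `M` there is a complex `0 → A ⊗ M → A ⊗ V ⊗ M → A ⊗ M → M → 0` of free modules
over `M`, whose left map is the noncommutative derivative of `f`. Its exactness away from the left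
end is formal: the universal derivation of `T(V)` is a contracting homotopy
(`exact_resolutionOne_resolutionZero`, `exact_resolutionTwo_resolutionOne`). Injectivity on the left
is a leading word argument (`resolutionTwo_injective`). So all projective dimensions are at most
`2`. For `M = k` the left map has image in the augmentation ideal times its target, hence does not
split, and `2` is attained.

Comparing leading words in an equation `f y = z f` would produce a self-overlap of `s`; this gives
the third claim and `W_m = 0` for `m > N`. The Koszul complex thus stops in degree `2`, where it is
the resolution for `M = k`. -/

noncomputable section

universe u v w

namespace NKoszul

/-! ### Words, their order, and overlaps -/

section Words

variable {n : ℕ}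

/-- The rank of a word in the degree-lexicographic order: its letters are read as the nonzero
digits of a natural number. -/
def wordRank (s : FreeMonoid (Fin n)) : ℕ :=
  Nat.ofDigits (n + 2) (s.toList.reverse.map fun i : Fin n => (i : ℕ) + 1)

/-- No letter gives the digit `0`, so the digits recover the word together with its length. The base
`n + 2` exceeds `1` even for `n = 0`. -/
theorem digits_wordRank (s : FreeMonoid (Fin n)) :
    Nat.digits (n + 2) (wordRank s) = s.toList.reverse.map fun i : Fin n => (i : ℕ) + 1 := by
  refine Nat.digits_ofDigits _ (by omega) _ ?_ ?_
  · simp only [List.mem_map, forall_exists_index, and_imp]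
    rintro _ i - rfl
    omega
  · intro h
    have := List.getLast_mem h
    simp only [List.mem_map] at this
    obtain ⟨i, -, hi⟩ := this
    omega

theorem wordRank_injective : Function.Injective (wordRank (n := n)) := by
  intro s t h
  have h' := congrArg (Nat.digits (n + 2)) h
  rw [digits_wordRank, digits_wordRank] at h'
  have hinj : Function.Injective fun i : Fin n => (i : ℕ) + 1 := fun i j hij => by
    simpa [Fin.ext_iff] using hij
  have := List.map_injective_iff.2 hinj h'
  exact FreeMonoid.toList.injective (List.reverse_injective this)

theorem wordRank_mul (s t : FreeMonoid (Fin n)) :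
    wordRank (s * t) = wordRank t + (n + 2) ^ t.toList.length * wordRank s := by
  simp [wordRank, FreeMonoid.toList_mul, Nat.ofDigits_append]

theorem length_le_of_wordRank_le {s t : FreeMonoid (Fin n)} (h : wordRank s ≤ wordRank t) :
    s.toList.length ≤ t.toList.length := by
  simpa [digits_wordRank] using Nat.le_length_digits_le (n + 2) _ _ h

theorem wordRank_lt_of_length_lt {s t : FreeMonoid (Fin n)}
    (h : s.toList.length < t.toList.length) : wordRank s < wordRank t := by
  by_contra! h'
  exact absurd (length_le_of_wordRank_le h') (by omega)

theorem wordRank_mul_lt_mul_left {s t : FreeMonoid (Fin n)} (a : FreeMonoid (Fin n))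
    (h : wordRank s < wordRank t) : wordRank (a * s) < wordRank (a * t) := by
  rw [wordRank_mul, wordRank_mul]
  exact add_lt_add_of_lt_of_le h (Nat.mul_le_mul_right _
    (Nat.pow_le_pow_right (by omega) (length_le_of_wordRank_le h.le)))

theorem wordRank_mul_lt_mul_right {s t : FreeMonoid (Fin n)} (a : FreeMonoid (Fin n))
    (h : wordRank s < wordRank t) : wordRank (s * a) < wordRank (t * a) := by
  rw [wordRank_mul, wordRank_mul]
  exact Nat.add_lt_add_left (Nat.mul_lt_mul_of_pos_left h (by positivity)) _

/-- A word is normal with respect to `w` if it does not contain `w` as a factor. -/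
def IsNormal (w s : FreeMonoid (Fin n)) : Prop :=
  ∀ a c, s ≠ a * w * c

/-- Occurrences of a word without repeated letters do not overlap; hence the first occurrence
determines the factorization. -/
theorem eq_of_mul_mul_eq_of_nodup {w a a' c c' : FreeMonoid (Fin n)} (hw : w.toList.Nodup)
    (ha : IsNormal w a) (ha' : IsNormal w a') (h : a * w * c = a' * w * c') : a = a' := by
  wlog hl : a.toList.length ≤ a'.toList.length generalizing a a' c c'
  · exact (this ha' ha h.symm (by omega)).symm
  have h1 : a.toList ++ (w.toList ++ c.toList) = a'.toList ++ (w.toList ++ c'.toList) := by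
    simpa [FreeMonoid.toList_mul] using congrArg FreeMonoid.toList h
  obtain ⟨d, hd⟩ := List.prefix_of_prefix_length_le ⟨_, h1⟩ ⟨_, rfl⟩ hl
  -- With `a' = a d` the equation becomes `w c = d w c'`. Either `w` lies inside `d`, hence in `a'`,
  -- or `d` is an initial part of `w`.
  rw [← hd, List.append_assoc, List.append_cancel_left_eq] at h1
  rcases eq_or_ne d [] with rfl | hd0
  · exact FreeMonoid.toList.injective (by simpa using hd)
  exfalso
  rcases le_total w.toList.length d.length with hle | hle
  · obtain ⟨e, he⟩ := List.prefix_of_prefix_length_le ⟨_, h1⟩ ⟨_, rfl⟩ hle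
    refine ha' a (FreeMonoid.ofList e) (FreeMonoid.toList.injective ?_)
    simp [FreeMonoid.toList_mul, he, hd]
  · obtain ⟨e, he⟩ := List.prefix_of_prefix_length_le ⟨_, h1.symm⟩ ⟨_, rfl⟩ hle
    rcases d with - | ⟨x, d⟩
    · exact hd0 rfl
    rw [← he, List.append_assoc, List.append_cancel_left_eq] at h1
    rcases e with - | ⟨y, e⟩
    · refine ha' a 1 (FreeMonoid.toList.injective ?_)
      simp only [FreeMonoid.toList_mul, ← he, FreeMonoid.toList_one, List.append_nil]
      exact hd.symm
    -- The two parts of `w` begin with the same letter, which is then repeated.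
    · rw [← he] at hw
      simp only [List.cons_append, List.cons.injEq] at h1
      simp [h1.1] at hw

/-- If `w = w' x` has no repeated letters and `a` is normal, then so is `a w'`. -/
theorem IsNormal.mul_of_nodup {w' a : FreeMonoid (Fin n)} {x : Fin n}
    (hw : (w' * FreeMonoid.of x).toList.Nodup) (ha : IsNormal (w' * FreeMonoid.of x) a) :
    IsNormal (w' * FreeMonoid.of x) (a * w') := by
  intro c d h
  have h1 : a.toList ++ w'.toList = c.toList ++ (w'.toList ++ [x]) ++ d.toList := by
    simpa [FreeMonoid.toList_mul, FreeMonoid.toList_of] using congrArg FreeMonoid.toList h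
  have hx : x ∉ w'.toList := by
    simp only [FreeMonoid.toList_mul, FreeMonoid.toList_of, List.nodup_append] at hw
    exact fun h => hw.2.2 x h x (by simp) rfl
  rcases le_total w'.toList.length d.toList.length with hle | hle
  · obtain ⟨e, he⟩ := List.suffix_of_suffix_length_le ⟨_, h1⟩ ⟨_, rfl⟩ hle
    rw [← he, ← List.append_assoc, List.append_cancel_right_eq] at h1
    refine ha c (FreeMonoid.ofList e) (FreeMonoid.toList.injective ?_)
    simp [FreeMonoid.toList_mul, h1, FreeMonoid.toList_of]
  · obtain ⟨e, he⟩ := List.suffix_of_suffix_length_le ⟨_, h1.symm⟩ ⟨_, rfl⟩ hle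
    rw [← he, ← List.append_assoc, List.append_cancel_right_eq] at h1
    rcases List.eq_nil_or_concat e with rfl | ⟨e, y, rfl⟩
    · refine ha c 1 (FreeMonoid.toList.injective ?_)
      simp only [List.nil_append] at he
      simpa [FreeMonoid.toList_mul, FreeMonoid.toList_of, he] using h1
    -- The occurrence ends inside `w'`, so its last letter `x` is a letter of `w'`.
    · rw [← List.append_assoc, List.concat_eq_append, ← List.append_assoc] at h1
      have := (List.append_inj' h1 rfl).2
      simp only [List.cons.injEq, and_true] at this
      exact hx (by rw [← he, ← this]; simp)

/-- A word without repeated letters does not overlap with itself. -/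
theorem mul_ne_mul_of_nodup {w s t : FreeMonoid (Fin n)} (hw : w.toList.Nodup)
    (h0 : 0 < s.toList.length) (hs : s.toList.length < w.toList.length) : w * t ≠ s * w := by
  intro h
  have h1 : w.toList ++ t.toList = s.toList ++ w.toList := by
    simpa [FreeMonoid.toList_mul] using congrArg FreeMonoid.toList h
  obtain ⟨e, he⟩ := List.prefix_of_prefix_length_le ⟨_, h1.symm⟩ ⟨_, rfl⟩ hs.le
  generalize s.toList = s' at *
  generalize w.toList = w' at *
  subst he
  rw [List.append_assoc, List.append_cancel_left_eq] at h1
  rcases s' with - | ⟨x, s'⟩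
  · simp at h0
  rcases e with - | ⟨y, e⟩
  · simp at hs
  simp only [List.cons_append, List.cons.injEq] at h1
  simp [h1.1] at hw

end Words

/-! ### Leading words in the tensor algebra -/

section LeadingWords

variable {k : Type u} [Field k] {V : Type v} [AddCommGroup V] [Module k V] {n : ℕ}
  (b : Module.Basis (Fin n) k V)

theorem tensorAlgebra_basis_apply (s : FreeMonoid (Fin n)) :
    b.tensorAlgebra s = (s.toList.map fun i => TensorAlgebra.ι k (b i)).prod := by
  have h : b.tensorAlgebra s = (TensorAlgebra.equivFreeAlgebra b).symm
      (FreeAlgebra.basisFreeMonoid k (Fin n) s) := rfl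
  have h' : FreeAlgebra.basisFreeMonoid k (Fin n) s =
      (s.toList.map (FreeAlgebra.ι k)).prod := by
    have : FreeAlgebra.basisFreeMonoid k (Fin n) s =
        FreeAlgebra.equivMonoidAlgebraFreeMonoid.symm (MonoidAlgebra.of k _ s) := rfl
    rw [this, ← FreeMonoid.lift_apply (FreeAlgebra.ι k)]
    simp [FreeAlgebra.equivMonoidAlgebraFreeMonoid]
  rw [h, h', map_list_prod, List.map_map]
  congr 1
  refine List.map_congr_left fun i _ => ?_
  simp

theorem tensorAlgebra_basis_one : b.tensorAlgebra 1 = 1 := by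
  simp [tensorAlgebra_basis_apply]

theorem tensorAlgebra_basis_mul (s t : FreeMonoid (Fin n)) :
    b.tensorAlgebra (s * t) = b.tensorAlgebra s * b.tensorAlgebra t := by
  simp [tensorAlgebra_basis_apply, FreeMonoid.toList_mul]

theorem tensorAlgebra_basis_of (i : Fin n) :
    b.tensorAlgebra (FreeMonoid.of i) = TensorAlgebra.ι k (b i) := by
  simp [tensorAlgebra_basis_apply, FreeMonoid.toList_of]

/-- The span of the words that are smaller than `s`. -/
def lowerSpan (s : FreeMonoid (Fin n)) : Submodule k (TensorAlgebra k V) :=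
  Submodule.span k (b.tensorAlgebra '' {t | wordRank t < wordRank s})

variable {b}

theorem basis_mem_lowerSpan {s t : FreeMonoid (Fin n)} (h : wordRank t < wordRank s) :
    b.tensorAlgebra t ∈ lowerSpan b s :=
  Submodule.subset_span ⟨t, h, rfl⟩

theorem lowerSpan_mono {s t : FreeMonoid (Fin n)} (h : wordRank s ≤ wordRank t) :
    lowerSpan b s ≤ lowerSpan b t :=
  Submodule.span_mono (Set.image_mono fun _ hr => lt_of_lt_of_le hr h)

theorem basis_mul_mem_lowerSpan {s : FreeMonoid (Fin n)} (a : FreeMonoid (Fin n))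
    {x : TensorAlgebra k V} (hx : x ∈ lowerSpan b s) :
    b.tensorAlgebra a * x ∈ lowerSpan b (a * s) := by
  induction hx using Submodule.span_induction with
  | mem x hx =>
    obtain ⟨t, ht, rfl⟩ := hx
    rw [← tensorAlgebra_basis_mul]
    exact basis_mem_lowerSpan (wordRank_mul_lt_mul_left a ht)
  | zero => simp
  | add x y _ _ hx hy => rw [mul_add]; exact add_mem hx hy
  | smul c x _ hx => rw [mul_smul_comm]; exact Submodule.smul_mem _ _ hx

theorem mul_basis_mem_lowerSpan {s : FreeMonoid (Fin n)} (a : FreeMonoid (Fin n))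
    {x : TensorAlgebra k V} (hx : x ∈ lowerSpan b s) :
    x * b.tensorAlgebra a ∈ lowerSpan b (s * a) := by
  induction hx using Submodule.span_induction with
  | mem x hx =>
    obtain ⟨t, ht, rfl⟩ := hx
    rw [← tensorAlgebra_basis_mul]
    exact basis_mem_lowerSpan (wordRank_mul_lt_mul_right a ht)
  | zero => simp
  | add x y _ _ hx hy => rw [add_mul]; exact add_mem hx hy
  | smul c x _ hx => rw [smul_mul_assoc]; exact Submodule.smul_mem _ _ hx

theorem mul_mem_lowerSpan {s t : FreeMonoid (Fin n)} {x y : TensorAlgebra k V}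
    (hx : x ∈ lowerSpan b s) (hy : y ∈ lowerSpan b t) : x * y ∈ lowerSpan b (s * t) := by
  induction hx using Submodule.span_induction with
  | mem x hx =>
    obtain ⟨r, hr, rfl⟩ := hx
    exact lowerSpan_mono (wordRank_mul_lt_mul_right t hr).le (basis_mul_mem_lowerSpan r hy)
  | zero => simp
  | add x y _ _ hx hy => rw [add_mul]; exact add_mem hx hy
  | smul c x _ hx => rw [smul_mul_assoc]; exact Submodule.smul_mem _ _ hx

theorem repr_eq_zero_of_mem_lowerSpan {s t : FreeMonoid (Fin n)} {x : TensorAlgebra k V}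
    (hx : x ∈ lowerSpan b s) (h : wordRank s ≤ wordRank t) : b.tensorAlgebra.repr x t = 0 := by
  by_contra h0
  have := (b.tensorAlgebra.mem_span_image.1 hx) (Finsupp.mem_support_iff.2 h0)
  exact absurd h (not_le.2 this)

theorem mem_lowerSpan_iff {s : FreeMonoid (Fin n)} {x : TensorAlgebra k V} :
    x ∈ lowerSpan b s ↔ ∀ t, wordRank s ≤ wordRank t → b.tensorAlgebra.repr x t = 0 := by
  refine ⟨fun hx t h => repr_eq_zero_of_mem_lowerSpan hx h, fun h => ?_⟩
  refine b.tensorAlgebra.mem_span_image.2 fun t ht => ?_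
  by_contra h'
  exact Finsupp.mem_support_iff.1 ht (h t (not_lt.1 h'))

variable (b) in
/-- The word `s` is the leading word of `x`. -/
def HasLead (x : TensorAlgebra k V) (s : FreeMonoid (Fin n)) : Prop :=
  ∃ c : k, c ≠ 0 ∧ x - c • b.tensorAlgebra s ∈ lowerSpan b s

theorem exists_hasLead {x : TensorAlgebra k V} (hx : x ≠ 0) :
    ∃ s, HasLead b x s ∧ b.tensorAlgebra.repr x s ≠ 0 := by
  have hne : (b.tensorAlgebra.repr x).support.Nonempty := by
    rw [Finsupp.support_nonempty_iff]
    simpa using hx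
  obtain ⟨s, hs, hmax⟩ := Finset.exists_max_image _ wordRank hne
  have hs' := Finsupp.mem_support_iff.1 hs
  refine ⟨s, ⟨_, hs', ?_⟩, hs'⟩
  rw [mem_lowerSpan_iff]
  intro t ht
  by_cases hst : s = t
  · subst hst
    rw [map_sub, map_smul, Finsupp.sub_apply, Finsupp.smul_apply, Module.Basis.repr_self]
    simp
  · rw [map_sub, map_smul, Finsupp.sub_apply, Finsupp.smul_apply, Module.Basis.repr_self,
      Finsupp.single_eq_of_ne (Ne.symm hst), smul_zero, sub_zero]
    by_contra h0
    exact hst (wordRank_injective (le_antisymm ht (hmax t (Finsupp.mem_support_iff.2 h0))))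

theorem HasLead.repr_ne_zero {x : TensorAlgebra k V} {s : FreeMonoid (Fin n)}
    (h : HasLead b x s) : b.tensorAlgebra.repr x s ≠ 0 := by
  obtain ⟨c, hc, h⟩ := h
  have := repr_eq_zero_of_mem_lowerSpan h le_rfl
  simp only [map_sub, map_smul, Module.Basis.repr_self, Finsupp.sub_apply, Finsupp.smul_apply,
    Finsupp.single_eq_same, smul_eq_mul, mul_one, sub_eq_zero] at this
  rwa [this]

theorem HasLead.repr_eq_zero {x : TensorAlgebra k V} {s t : FreeMonoid (Fin n)}
    (h : HasLead b x s) (hst : wordRank s < wordRank t) : b.tensorAlgebra.repr x t = 0 := by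
  obtain ⟨c, hc, h⟩ := h
  have := repr_eq_zero_of_mem_lowerSpan h hst.le
  rw [map_sub, map_smul, Finsupp.sub_apply, Finsupp.smul_apply, Module.Basis.repr_self,
    Finsupp.single_eq_of_ne (fun h => by simp [h] at hst), smul_zero, sub_zero] at this
  exact this

theorem HasLead.unique {x : TensorAlgebra k V} {s t : FreeMonoid (Fin n)}
    (hs : HasLead b x s) (ht : HasLead b x t) : s = t := by
  apply wordRank_injective
  apply le_antisymm
  · by_contra! h
    exact hs.repr_ne_zero (ht.repr_eq_zero h)
  · by_contra! h
    exact ht.repr_ne_zero (hs.repr_eq_zero h)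

theorem hasLead_basis (s : FreeMonoid (Fin n)) : HasLead b (b.tensorAlgebra s) s :=
  ⟨1, one_ne_zero, by simp⟩

/-- The order is compatible with concatenation on both sides, so all cross terms are smaller than `s
* t`. -/
theorem HasLead.mul {x y : TensorAlgebra k V} {s t : FreeMonoid (Fin n)}
    (hx : HasLead b x s) (hy : HasLead b y t) : HasLead b (x * y) (s * t) := by
  obtain ⟨c, hc, hx⟩ := hx
  obtain ⟨d, hd, hy⟩ := hy
  refine ⟨c * d, mul_ne_zero hc hd, ?_⟩
  have : x * y - (c * d) • b.tensorAlgebra (s * t) =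
      (x - c • b.tensorAlgebra s) * (y - d • b.tensorAlgebra t) +
      (c • (b.tensorAlgebra s * (y - d • b.tensorAlgebra t)) +
      d • ((x - c • b.tensorAlgebra s) * b.tensorAlgebra t)) := by
    rw [tensorAlgebra_basis_mul]
    simp only [mul_sub, sub_mul, smul_sub, mul_smul_comm, smul_mul_assoc, smul_smul]
    rw [mul_comm d c]
    abel
  rw [this]
  exact add_mem (mul_mem_lowerSpan hx hy) (add_mem
    (Submodule.smul_mem _ _ (basis_mul_mem_lowerSpan s hy))
    (Submodule.smul_mem _ _ (mul_basis_mem_lowerSpan t hx)))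

/-- Elements with pairwise distinct leading words: the leading word of a nonzero linear
combination is one of these words. -/
theorem exists_hasLead_of_mem_span {ι : Type*} {x : ι → TensorAlgebra k V}
    {s : ι → FreeMonoid (Fin n)} (hx : ∀ i, HasLead b (x i) (s i)) (hs : Function.Injective s)
    {y : TensorAlgebra k V} (hy : y ∈ Submodule.span k (Set.range x)) (hy0 : y ≠ 0) :
    ∃ i, HasLead b y (s i) := by
  classical
  obtain ⟨c, rfl⟩ := (Finsupp.mem_span_range_iff_exists_finsupp).1 hy
  have hne : c.support.Nonempty := by
    rw [Finsupp.support_nonempty_iff]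
    rintro rfl
    simp at hy0
  obtain ⟨i, hi, hmax⟩ := Finset.exists_max_image _ (fun i => wordRank (s i)) hne
  obtain ⟨d, hd, hd'⟩ := hx i
  refine ⟨i, c i * d, mul_ne_zero (Finsupp.mem_support_iff.1 hi) hd, ?_⟩
  rw [Finsupp.sum, ← Finset.add_sum_erase _ _ hi, add_sub_right_comm, mul_smul, ← smul_sub]
  refine add_mem (Submodule.smul_mem _ _ hd') (Submodule.sum_mem _ fun j hj => ?_)
  refine Submodule.smul_mem _ _ ?_
  rw [Finset.mem_erase] at hj
  have hlt : wordRank (s j) < wordRank (s i) :=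
    lt_of_le_of_ne (hmax j hj.2) fun h => hj.1 (hs (wordRank_injective h))
  obtain ⟨e, -, he⟩ := hx j
  rw [← sub_add_cancel (x j) (e • b.tensorAlgebra (s j))]
  exact add_mem (lowerSpan_mono hlt.le he) (Submodule.smul_mem _ _ (basis_mem_lowerSpan hlt))

end LeadingWords

/-! ### Gröbner basis of the ideal generated by one tensor -/

section OneRelation

variable {k : Type u} [Field k] {V : Type v} [AddCommGroup V] [Module k V] {N n : ℕ}

theorem Alg.mk_eq_zero_iff (R : Submodule k ((⨂[k]^N) V)) {x : TensorAlgebra k V} :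
    Alg.mk R x = 0 ↔ x ∈ relIdeal R :=
  Ideal.Quotient.eq_zero_iff_mem

theorem Alg.mk_surjective (R : Submodule k ((⨂[k]^N) V)) : Function.Surjective (Alg.mk R) :=
  Ideal.Quotient.mk_surjective

theorem Alg.mk_eq_zero_of_mem_rel {R : Submodule k ((⨂[k]^N) V)} {x : TensorAlgebra k V}
    (hx : x ∈ rel R) : Alg.mk R x = 0 :=
  (Alg.mk_eq_zero_iff R).2 (TwoSidedIdeal.subset_span hx)

theorem rel_span_singleton (f : (⨂[k]^N) V) :
    rel (Submodule.span k {f}) = Submodule.span k {TensorPower.toTensorAlgebra f} := by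
  rw [rel, Submodule.map_span, Set.image_singleton]

theorem mk_toTensorAlgebra_eq_zero (f : (⨂[k]^N) V) :
    Alg.mk (Submodule.span k {f}) (TensorPower.toTensorAlgebra f) = 0 := by
  apply Alg.mk_eq_zero_of_mem_rel
  rw [rel_span_singleton]
  exact Submodule.mem_span_singleton_self _

/-- The ideal of relations is spanned by the products `x f y`. -/
theorem relIdeal_induction {f : (⨂[k]^N) V} {P : Submodule k (TensorAlgebra k V)}
    (h : ∀ x y, x * TensorPower.toTensorAlgebra f * y ∈ P) {z : TensorAlgebra k V}
    (hz : z ∈ relIdeal (Submodule.span k {f})) : z ∈ P := by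
  have hz' : z ∈ TwoSidedIdeal.span
    (rel (Submodule.span k {f}) : Set (TensorAlgebra k V)) := hz
  rw [TwoSidedIdeal.mem_span_iff_mem_addSubgroup_closure] at hz'
  refine (AddSubgroup.closure_le P.toAddSubgroup).2 ?_ hz'
  rintro _ ⟨_, ⟨x, -, r, hr, rfl⟩, y, -, rfl⟩
  rw [rel_span_singleton] at hr
  obtain ⟨c, rfl⟩ := Submodule.mem_span_singleton.1 hr
  have := P.smul_mem c (h x y)
  simpa using this

variable {b : Module.Basis (Fin n) k V} {f : (⨂[k]^N) V} {s : FreeMonoid (Fin n)}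

/-- Induction on the word to the left of `f`. If it is `c s d`, replace this `s` by a multiple of
`f` minus smaller words: `c f (d f y)` has the shorter left word `c`, the remaining terms have
smaller left words. Only the left factor is made normal; with that restriction the words `a s c` are
pairwise distinct. -/
theorem mul_mul_mem_span_of_isNormal (hf : HasLead b (TensorPower.toTensorAlgebra f) s)
    (hs : s ≠ 1) (x y : TensorAlgebra k V) :
    x * TensorPower.toTensorAlgebra f * y ∈ Submodule.span k (Set.range
      fun p : {a // IsNormal s a} × FreeMonoid (Fin n) =>
        b.tensorAlgebra p.1 * TensorPower.toTensorAlgebra f * b.tensorAlgebra p.2) := by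
  set F : TensorAlgebra k V := TensorPower.toTensorAlgebra f
  set P := Submodule.span k (Set.range
      fun p : {a // IsNormal s a} × FreeMonoid (Fin n) =>
        b.tensorAlgebra p.1 * F * b.tensorAlgebra p.2)
  have hlin : ∀ a, (∀ y, b.tensorAlgebra a * F * b.tensorAlgebra y ∈ P) →
      ∀ y, b.tensorAlgebra a * F * y ∈ P := by
    intro a ha y
    induction b.tensorAlgebra.mem_span y using Submodule.span_induction with
    | mem y hy => obtain ⟨t, rfl⟩ := hy; exact ha t
    | zero => simp
    | add y z _ _ hy hz => rw [mul_add]; exact add_mem hy hz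
    | smul c y _ hy => rw [mul_smul_comm]; exact P.smul_mem _ hy
  have key : ∀ m : ℕ, ∀ a, wordRank a = m → ∀ y, b.tensorAlgebra a * F * y ∈ P := by
    intro m
    induction m using Nat.strong_induction_on with
    | _ m ih =>
    rintro a rfl
    by_cases ha : IsNormal s a
    · exact hlin a fun y => Submodule.subset_span ⟨(⟨a, ha⟩, y), rfl⟩
    intro y
    have hlow : ∀ z ∈ lowerSpan b a, z * F * y ∈ P := by
      intro z hz
      induction hz using Submodule.span_induction with
      | mem z hz => obtain ⟨t, ht, rfl⟩ := hz; exact ih _ ht t rfl y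
      | zero => simp
      | add x z _ _ hx hz => rw [add_mul, add_mul]; exact add_mem hx hz
      | smul c z _ hz => rw [smul_mul_assoc, smul_mul_assoc]; exact P.smul_mem _ hz
    simp only [IsNormal, not_forall, not_not] at ha
    obtain ⟨c, d, rfl⟩ := ha
    have hc : wordRank c < wordRank (c * s * d) := by
      apply wordRank_lt_of_length_lt
      have : s.toList.length ≠ 0 := fun h =>
        hs (FreeMonoid.toList.injective (List.length_eq_zero_iff.1 h))
      simp only [FreeMonoid.toList_mul, List.length_append]
      omega
    obtain ⟨e, he, hl⟩ := hf
    have h1 := mul_basis_mem_lowerSpan d (basis_mul_mem_lowerSpan c hl)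
    have h2 := P.sub_mem (ih _ hc c rfl (b.tensorAlgebra d * F * y)) (hlow _ h1)
    have h3 := P.smul_mem e⁻¹ h2
    convert h3 using 1
    simp only [tensorAlgebra_basis_mul, mul_sub, sub_mul, mul_smul_comm, smul_mul_assoc, F,
      mul_assoc, sub_sub_cancel, smul_smul, inv_mul_cancel₀ he, one_smul]
  induction b.tensorAlgebra.mem_span x using Submodule.span_induction with
  | mem x hx => obtain ⟨a, rfl⟩ := hx; exact key _ a rfl y
  | zero => simp
  | add x z _ _ hx hz => rw [add_mul, add_mul]; exact add_mem hx hz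
  | smul c x _ hx => rw [smul_mul_assoc, smul_mul_assoc]; exact P.smul_mem _ hx

/-- The leading words of the elements of the ideal generated by `f` contain the leading word of
`f`, if the latter has no repeated letters. -/
theorem exists_hasLead_of_mem_relIdeal (hf : HasLead b (TensorPower.toTensorAlgebra f) s)
    (hs : s ≠ 1) (hs' : s.toList.Nodup) {x : TensorAlgebra k V}
    (hx : x ∈ relIdeal (Submodule.span k {f})) (hx0 : x ≠ 0) :
    ∃ a c, HasLead b x (a * s * c) := by
  have h := relIdeal_induction (mul_mul_mem_span_of_isNormal hf hs) hx
  obtain ⟨⟨a, c⟩, hac⟩ := exists_hasLead_of_mem_span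
    (s := fun p : {a // IsNormal s a} × FreeMonoid (Fin n) => (p.1 : FreeMonoid (Fin n)) * s * p.2)
    (fun p => ((hasLead_basis _).mul hf).mul (hasLead_basis _)) (by
      rintro ⟨⟨a, ha⟩, c⟩ ⟨⟨a', ha'⟩, c'⟩ h
      obtain rfl : a = a' := eq_of_mul_mul_eq_of_nodup hs' ha ha' h
      obtain rfl : c = c' := mul_left_cancel h
      rfl) h hx0
  exact ⟨a, c, hac⟩

/-- A normal word is not a linear combination of smaller words in the quotient algebra. -/
theorem exists_dual_of_isNormal (hf : HasLead b (TensorPower.toTensorAlgebra f) s)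
    (hs : s ≠ 1) (hs' : s.toList.Nodup) {a : FreeMonoid (Fin n)} (ha : IsNormal s a) :
    ∃ φ : Alg (Submodule.span k {f}) →ₗ[k] k, φ (Alg.mk _ (b.tensorAlgebra a)) ≠ 0 ∧
      ∀ x ∈ lowerSpan b a, φ (Alg.mk _ x) = 0 := by
  obtain ⟨φ, h1, h2⟩ := Submodule.exists_le_ker_of_notMem
    (p := (lowerSpan b a).map (Alg.mk (Submodule.span k {f})).toLinearMap)
    (v := Alg.mk _ (b.tensorAlgebra a)) (by
      rintro ⟨x, hx, hxa⟩
      have h0 : b.tensorAlgebra a - x ∈ relIdeal (Submodule.span k {f}) := by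
        rw [← Alg.mk_eq_zero_iff, map_sub, sub_eq_zero]
        exact hxa.symm
      -- If the class of `a` were a combination of smaller words, the ideal would contain an element
      -- with leading word `a`, which avoids `s`.
      have hl : HasLead b (b.tensorAlgebra a - x) a := ⟨1, one_ne_zero, by simpa using hx⟩
      obtain ⟨c, d, hcd⟩ := exists_hasLead_of_mem_relIdeal hf hs hs' h0 (by
        intro h
        apply hl.repr_ne_zero
        rw [h, map_zero, Finsupp.zero_apply])
      exact ha c d (hl.unique hcd))
  exact ⟨φ, h1, fun x hx => h2 ⟨x, hx, rfl⟩⟩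

/-- The normal words span the quotient algebra. -/
theorem span_isNormal (hf : HasLead b (TensorPower.toTensorAlgebra f) s) :
    Submodule.span k (Set.range fun a : {a // IsNormal s a} =>
      Alg.mk (Submodule.span k {f}) (b.tensorAlgebra a)) = ⊤ := by
  set P := Submodule.span k (Set.range fun a : {a // IsNormal s a} =>
      Alg.mk (Submodule.span k {f}) (b.tensorAlgebra a))
  have key : ∀ m : ℕ, ∀ a, wordRank a = m → Alg.mk _ (b.tensorAlgebra a) ∈ P := by
    intro m
    induction m using Nat.strong_induction_on with
    | _ m ih =>
    rintro a rfl
    by_cases ha : IsNormal s a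
    · exact Submodule.subset_span ⟨⟨a, ha⟩, rfl⟩
    have hlow : ∀ z ∈ lowerSpan b a, Alg.mk _ z ∈ P := by
      intro z hz
      induction hz using Submodule.span_induction with
      | mem z hz => obtain ⟨t, ht, rfl⟩ := hz; exact ih _ ht t rfl
      | zero => simp
      | add x z _ _ hx hz => rw [map_add]; exact add_mem hx hz
      | smul c z _ hz => rw [map_smul]; exact P.smul_mem _ hz
    simp only [IsNormal, not_forall, not_not] at ha
    obtain ⟨c, d, rfl⟩ := ha
    obtain ⟨e, he, hl⟩ := hf
    have h1 := P.smul_mem (-e⁻¹) (hlow _ (mul_basis_mem_lowerSpan d (basis_mul_mem_lowerSpan c hl)))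
    convert h1 using 1
    simp [tensorAlgebra_basis_mul, mul_sub, sub_mul, mk_toTensorAlgebra_eq_zero, smul_smul, he]
  rw [eq_top_iff]
  rintro x -
  obtain ⟨x, rfl⟩ := Alg.mk_surjective _ x
  induction b.tensorAlgebra.mem_span x using Submodule.span_induction with
  | mem x hx => obtain ⟨a, rfl⟩ := hx; exact key _ a rfl
  | zero => simp
  | add x z _ _ hx hz => rw [map_add]; exact add_mem hx hz
  | smul c x _ hx => rw [map_smul]; exact P.smul_mem _ hx

end OneRelation

/-! ### Words in an antisymmetric tensor -/

section Antisymmetric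

variable {k : Type u} [Field k] {V : Type v} [AddCommGroup V] [Module k V] {N n : ℕ}
  (b : Module.Basis (Fin n) k V)

theorem tpow_le_span (m : ℕ) :
    tpow k V m ≤ Submodule.span k (b.tensorAlgebra '' {s | s.toList.length = m}) := by
  induction m with
  | zero =>
    rw [tpow, pow_zero, Submodule.one_le]
    exact Submodule.subset_span ⟨1, rfl, tensorAlgebra_basis_one b⟩
  | succ m ih =>
    rw [tpow, pow_succ, Submodule.mul_le]
    rintro x hx _ ⟨v, rfl⟩
    replace hx := ih hx
    clear ih
    induction hx using Submodule.span_induction with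
    | mem x hx =>
      obtain ⟨s, hs, rfl⟩ := hx
      rw [← b.sum_repr v, map_sum, Finset.mul_sum]
      refine Submodule.sum_mem _ fun i _ => ?_
      rw [map_smul, mul_smul_comm, ← tensorAlgebra_basis_of, ← tensorAlgebra_basis_mul]
      refine Submodule.smul_mem _ _ (Submodule.subset_span ⟨_, ?_, rfl⟩)
      simpa [FreeMonoid.toList_mul, FreeMonoid.toList_of] using hs
    | zero => simp
    | add x z _ _ hx hz => rw [add_mul]; exact add_mem hx hz
    | smul c x _ hx => rw [smul_mul_assoc]; exact Submodule.smul_mem _ _ hx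

theorem length_eq_of_mem_tpow {m : ℕ} {x : TensorAlgebra k V} (hx : x ∈ tpow k V m)
    {s : FreeMonoid (Fin n)} (hs : b.tensorAlgebra.repr x s ≠ 0) : s.toList.length = m :=
  b.tensorAlgebra.mem_span_image.1 (tpow_le_span b m hx) (Finsupp.mem_support_iff.2 hs)

theorem toTensorAlgebra_tprod_basis (g : Fin N → Fin n) :
    TensorPower.toTensorAlgebra (PiTensorProduct.tprod k fun i => b (g i)) =
      b.tensorAlgebra (FreeMonoid.ofList (List.ofFn g)) := by
  rw [TensorPower.toTensorAlgebra_tprod, TensorAlgebra.tprod_apply, tensorAlgebra_basis_apply]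
  simp [List.map_ofFn, Function.comp_def]

/-- The words that occur in an antisymmetric tensor have no repeated letters. -/
theorem IsAntisymmetric.nodup [CharZero k] {f : (⨂[k]^N) V} (hf : IsAntisymmetric f)
    {s : FreeMonoid (Fin n)}
    (hs : b.tensorAlgebra.repr (TensorPower.toTensorAlgebra f) s ≠ 0) : s.toList.Nodup := by
  have hlen : s.toList.length = N := by
    refine length_eq_of_mem_tpow b (x := TensorPower.toTensorAlgebra f) ?_ hs
    rw [← range_toTensorAlgebra]
    exact ⟨f, rfl⟩
  obtain ⟨g, rfl⟩ : ∃ g : Fin N → Fin n, s = FreeMonoid.ofList (List.ofFn g) :=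
    ⟨fun i => s.toList.get (i.cast hlen.symm), FreeMonoid.toList.injective
      (List.ext_get (by simpa using hlen) (by simp))⟩
  rw [FreeMonoid.toList_ofList, List.nodup_ofFn]
  by_contra hg
  simp only [Function.Injective, not_forall] at hg
  obtain ⟨p, q, hpq, hne⟩ := hg
  let L : (⨂[k]^N) V →ₗ[k] k :=
    b.tensorAlgebra.coord (FreeMonoid.ofList (List.ofFn g)) ∘ₗ TensorPower.toTensorAlgebra
  -- The letters at `p` and `q` agree, so the coefficient of this word is invariant under the
  -- transposition; antisymmetry makes it its own negative.
  have hL : L ∘ₗ (PiTensorProduct.reindex k (fun _ : Fin N => V)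
      (Equiv.swap p q)).toLinearMap = L := by
    refine PiTensorProduct.ext (Module.Basis.ext_multilinear (fun _ => b) fun h => ?_)
    simp only [LinearMap.compMultilinearMap_apply, LinearMap.comp_apply, LinearEquiv.coe_coe, L,
      Module.Basis.coord_apply]
    have hg' : g ∘ Equiv.swap p q = g := by
      ext i
      rcases eq_or_ne i p with rfl | hi
      · simp [hpq]
      rcases eq_or_ne i q with rfl | hi'
      · simp [hpq]
      · simp [Equiv.swap_apply_of_ne_of_ne hi hi']
    have hr : PiTensorProduct.reindex k (fun _ : Fin N => V) (Equiv.swap p q)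
        (PiTensorProduct.tprod k fun i => b (h i)) =
        PiTensorProduct.tprod k fun i => b ((h ∘ Equiv.swap p q) i) := by
      rw [PiTensorProduct.reindex_tprod]
      rfl
    rw [hr, toTensorAlgebra_tprod_basis, toTensorAlgebra_tprod_basis, Module.Basis.repr_self,
      Module.Basis.repr_self]
    classical
    rw [Finsupp.single_apply, Finsupp.single_apply]
    congr 1
    simp only [EmbeddingLike.apply_eq_iff_eq, List.ofFn_inj, eq_iff_iff]
    constructor
    · intro e
      rw [← hg', ← e, Function.comp_assoc]
      ext; simp
    · rintro rfl
      exact hg'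
  have h1 := LinearMap.congr_fun hL f
  rw [LinearMap.comp_apply, LinearEquiv.coe_coe, hf, Equiv.Perm.sign_swap hne, map_smul] at h1
  simp only [Units.val_neg, Units.val_one, Int.cast_neg, Int.cast_one, neg_smul, one_smul] at h1
  exact hs (self_eq_neg.1 h1.symm)

end Antisymmetric

/-! ### The complex of a module and the universal derivation -/

section Resolution

variable {k : Type u} [Field k] {V : Type v} [AddCommGroup V] [Module k V] {N : ℕ}
  (R : Submodule k ((⨂[k]^N) V))
  (M : Type w) [AddCommGroup M] [Module k M] [Module (Alg R) M] [IsScalarTower k (Alg R) M]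

variable {R M} in
/-- The `A`-linear map `A ⊗ P → M` that extends a `k`-linear map `P → M`. -/
def extendLinear {P : Type*} [AddCommGroup P] [Module k P] (g : P →ₗ[k] M) :
    Alg R ⊗[k] P →ₗ[Alg R] M :=
  TensorProduct.AlgebraTensorModule.lift (LinearMap.toSpanSingleton (Alg R) _ g)

variable {R M} in
@[simp]
theorem extendLinear_tmul {P : Type*} [AddCommGroup P] [Module k P] (g : P →ₗ[k] M)
    (a : Alg R) (p : P) : extendLinear g (a ⊗ₜ p) = a • g p := by
  simp [extendLinear]

/-- The action of `T(V)` on the extension of `M` by `A ⊗ V ⊗ M` for which `v` sends `m` to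
`(1 ⊗ v ⊗ m, v m)`. -/
def extensionAction :
    TensorAlgebra k V →ₐ[k] Module.End k ((Alg R ⊗[k] (V ⊗[k] M)) × M) :=
  TensorAlgebra.lift k (LinearMap.mk₂ k
    (fun v p => (Alg.mk R (TensorAlgebra.ι k v) • p.1 + 1 ⊗ₜ (v ⊗ₜ p.2),
      Alg.mk R (TensorAlgebra.ι k v) • p.2))
    (fun v v' p => by
      ext
      · simp [add_smul, TensorProduct.add_tmul, TensorProduct.tmul_add]; abel
      · simp [add_smul])
    (fun c v p => by
      ext
      · simp [TensorProduct.tmul_smul, ← TensorProduct.smul_tmul' c v]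
      · simp)
    (fun v p p' => by
      ext
      · simp [TensorProduct.tmul_add]; abel
      · simp)
    (fun c v p => by
      ext
      · simp [TensorProduct.tmul_smul, smul_comm _ c p.1]
      · simp [smul_comm _ c p.2]))

/-- The universal derivation of `T(V)` with values in `Hom(M, A ⊗ V ⊗ M)`: it sends
`v₁ ⋯ vᵣ` to the map `m ↦ ∑ v₁ ⋯ vᵢ₋₁ ⊗ vᵢ ⊗ vᵢ₊₁ ⋯ vᵣ m`. -/
def derivation : TensorAlgebra k V →ₗ[k] M →ₗ[k] Alg R ⊗[k] (V ⊗[k] M) :=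
  LinearMap.mk₂ k (fun t m => (extensionAction R M t (0, m)).1)
    (by simp) (by simp)
    (fun t m m' => by
      rw [← Prod.fst_add, ← map_add, Prod.mk_add_mk, add_zero])
    (fun c t m => by
      rw [← Prod.smul_fst, ← map_smul, Prod.smul_mk, smul_zero])

variable {M}

/-- The action is triangular, with the derivation as its off-diagonal entry. Its multiplicativity is
therefore the Leibniz rule `derivation_mul`. -/
theorem extensionAction_apply (t : TensorAlgebra k V) (e : Alg R ⊗[k] (V ⊗[k] M)) (m : M) :
    extensionAction R M t (e, m) =
      (Alg.mk R t • e + derivation R M t m, Alg.mk R t • m) := by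
  have hd : ∀ t m, derivation R M t m = (extensionAction R M t (0, m)).1 := fun _ _ => rfl
  rw [hd]
  induction t using TensorAlgebra.induction generalizing e m with
  | algebraMap c => simp [Algebra.algebraMap_eq_smul_one]
  | ι v => simp [extensionAction]
  | mul s t hs ht =>
    rw [map_mul, Module.End.mul_apply, Module.End.mul_apply, ht e, ht 0, hs, hs (_ + _)]
    simp [mul_smul, add_assoc]
  | add s t hs ht =>
    rw [map_add, LinearMap.add_apply, LinearMap.add_apply, hs e, ht e]
    ext
    · simp [add_smul]; abel
    · simp [add_smul]

theorem derivation_ι (v : V) (m : M) :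
    derivation R M (TensorAlgebra.ι k v) m = 1 ⊗ₜ (v ⊗ₜ m) := by
  simp [derivation, extensionAction]

theorem derivation_mul (s t : TensorAlgebra k V) (m : M) :
    derivation R M (s * t) m =
      Alg.mk R s • derivation R M t m + derivation R M s (Alg.mk R t • m) := by
  have h : derivation R M (s * t) m = (extensionAction R M (s * t) (0, m)).1 := rfl
  rw [h, map_mul, Module.End.mul_apply, extensionAction_apply, extensionAction_apply]
  simp

theorem derivation_one (m : M) : derivation R M 1 m = 0 := by
  simp [derivation]

variable (M) in
/-- The differential `A ⊗ V ⊗ M → A ⊗ M`, `a ⊗ v ⊗ m ↦ a v ⊗ m - a ⊗ v m`. -/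
def resolutionOne : Alg R ⊗[k] (V ⊗[k] M) →ₗ[Alg R] Alg R ⊗[k] M :=
  extendLinear (TensorProduct.lift (LinearMap.mk₂ k
    (fun v m => Alg.mk R (TensorAlgebra.ι k v) ⊗ₜ m - 1 ⊗ₜ (Alg.mk R (TensorAlgebra.ι k v) • m))
    (fun v v' m => by simp [add_smul, TensorProduct.add_tmul, TensorProduct.tmul_add]; abel)
    (fun c v m => by simp [TensorProduct.smul_tmul', TensorProduct.tmul_smul, smul_sub])
    (fun v m m' => by simp [TensorProduct.tmul_add]; abel)
    (fun c v m => by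
      rw [smul_comm _ c m]
      simp [TensorProduct.tmul_smul, smul_sub])))

@[simp]
theorem resolutionOne_tmul (a : Alg R) (v : V) (m : M) :
    resolutionOne R M (a ⊗ₜ (v ⊗ₜ m)) =
      (a * Alg.mk R (TensorAlgebra.ι k v)) ⊗ₜ m -
        a ⊗ₜ (Alg.mk R (TensorAlgebra.ι k v) • m) := by
  simp [resolutionOne, smul_sub, TensorProduct.smul_tmul']

variable (M) in
/-- The augmentation `A ⊗ M → M`, `a ⊗ m ↦ a m`. -/
def resolutionZero : Alg R ⊗[k] M →ₗ[Alg R] M :=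
  extendLinear LinearMap.id

@[simp]
theorem resolutionZero_tmul (a : Alg R) (m : M) : resolutionZero R M (a ⊗ₜ m) = a • m := by
  simp [resolutionZero]

variable (M) in
/-- The differential `A ⊗ M → A ⊗ V ⊗ M` that is given by the derivative of a tensor `f`. -/
def resolutionTwo (f : (⨂[k]^N) V) : Alg R ⊗[k] M →ₗ[Alg R] Alg R ⊗[k] (V ⊗[k] M) :=
  extendLinear (derivation R M (TensorPower.toTensorAlgebra f))

@[simp]
theorem resolutionTwo_tmul (f : (⨂[k]^N) V) (a : Alg R) (m : M) :
    resolutionTwo R M f (a ⊗ₜ m) = a • derivation R M (TensorPower.toTensorAlgebra f) m := by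
  simp [resolutionTwo]

theorem resolutionZero_surjective : Function.Surjective (resolutionZero R M) :=
  fun m => ⟨1 ⊗ₜ m, by simp⟩

/-- On a word the sum telescopes; only the terms with all letters on the left or all on the right of
the tensor sign survive. This is the homotopy identity behind exactness. -/
theorem resolutionOne_derivation (t : TensorAlgebra k V) (m : M) :
    resolutionOne R M (derivation R M t m) = Alg.mk R t ⊗ₜ m - 1 ⊗ₜ (Alg.mk R t • m) := by
  induction t using TensorAlgebra.induction generalizing m with
  | algebraMap c =>
    simp [Algebra.algebraMap_eq_smul_one, derivation_one, TensorProduct.smul_tmul]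
  | ι v => simp [derivation_ι]
  | mul s t hs ht =>
    rw [derivation_mul, map_add, map_smul, hs, ht]
    simp [smul_sub, TensorProduct.smul_tmul', mul_smul]
  | add s t hs ht =>
    rw [map_add, LinearMap.add_apply, map_add, hs, ht]
    simp [TensorProduct.add_tmul, TensorProduct.tmul_add, add_smul]; abel

theorem exact_resolutionOne_resolutionZero :
    Function.Exact (resolutionOne R M) (resolutionZero R M) := by
  have h1 : ∀ z : Alg R ⊗[k] M,
      z - 1 ⊗ₜ resolutionZero R M z ∈ LinearMap.range (resolutionOne R M) := by
    intro z
    induction z using TensorProduct.induction_on with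
    | zero => simp
    | tmul a m =>
      obtain ⟨t, rfl⟩ := Alg.mk_surjective R a
      exact ⟨derivation R M t m, by rw [resolutionOne_derivation, resolutionZero_tmul]⟩
    | add y z hy hz =>
      rw [map_add, TensorProduct.tmul_add, add_sub_add_comm]
      exact add_mem hy hz
  intro z
  refine ⟨fun h => by simpa [h] using h1 z, ?_⟩
  rintro ⟨y, rfl⟩
  rw [← LinearMap.comp_apply]
  induction y using TensorProduct.induction_on with
  | zero => simp
  | tmul a p =>
    induction p using TensorProduct.induction_on with
    | zero => simp
    | tmul v m => simp [mul_smul]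
    | add y z hy hz => rw [TensorProduct.tmul_add, map_add, hy, hz, add_zero]
  | add y z hy hz => rw [map_add, hy, hz, add_zero]

end Resolution

/-! ### Exactness at the middle term -/

section Relation

variable {k : Type u} [Field k] {V : Type v} [AddCommGroup V] [Module k V] {N : ℕ}
  {f : (⨂[k]^N) V} {R : Submodule k ((⨂[k]^N) V)}
  {M : Type w} [AddCommGroup M] [Module k M] [Module (Alg R) M] [IsScalarTower k (Alg R) M]

/-- Since `f` acts as zero, the derivation sends `x f y` and `m` to `x D(f)(y m)`, in the image of
`resolutionTwo`. Modulo that image it descends from `T(V)` to `A`, where it inverts `resolutionOne`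
on the left up to the quotient map. -/
theorem exact_resolutionTwo_resolutionOne (hR : R = Submodule.span k {f}) :
    Function.Exact (resolutionTwo R M f) (resolutionOne R M) := by
  set F : TensorAlgebra k V := TensorPower.toTensorAlgebra f with hF
  set P := (LinearMap.range (resolutionTwo R M f)).restrictScalars k
  have hF0 : Alg.mk R F = 0 := by
    subst hR; exact mk_toTensorAlgebra_eq_zero f
  have hI : ∀ t ∈ relIdeal R, ∀ m : M, derivation R M t m ∈ P := by
    intro t ht m
    refine relIdeal_induction (P := P.comap ((derivation R M).flip m)) (fun x y => ?_) (hR ▸ ht)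
    rw [Submodule.mem_comap, LinearMap.flip_apply, mul_assoc, derivation_mul, derivation_mul]
    rw [← hF, map_mul, hF0, zero_mul, zero_smul, zero_smul, map_zero, add_zero, zero_add]
    exact ⟨Alg.mk R x ⊗ₜ (Alg.mk R y • m), by rw [resolutionTwo_tmul]⟩
  -- the homotopy, with values in the cokernel
  let h : Alg R →ₗ[k] M →ₗ[k] ((Alg R ⊗[k] (V ⊗[k] M)) ⧸ P) :=
    ((Submodule.restrictScalars k (relIdeal R)).liftQ
      ((LinearMap.llcomp k M _ _ P.mkQ) ∘ₗ derivation R M) (fun t ht => by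
        ext m
        simpa using hI t ht m))
  have h_mk : ∀ t m, h (Alg.mk R t) m = P.mkQ (derivation R M t m) := fun t m => rfl
  have key : ∀ z, TensorProduct.lift h (resolutionOne R M z) = P.mkQ z := by
    intro z
    induction z using TensorProduct.induction_on with
    | zero => simp
    | tmul a p =>
      induction p using TensorProduct.induction_on with
      | zero => simp
      | tmul v m =>
        obtain ⟨t, rfl⟩ := Alg.mk_surjective R a
        rw [resolutionOne_tmul, map_sub, TensorProduct.lift.tmul, TensorProduct.lift.tmul,
          ← map_mul, h_mk, h_mk, derivation_mul, map_add, add_sub_cancel_right, derivation_ι,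
          TensorProduct.smul_tmul', smul_eq_mul, mul_one]
      | add y z hy hz => rw [TensorProduct.tmul_add, map_add, map_add, hy, hz, map_add]
    | add y z hy hz => rw [map_add, map_add, hy, hz, map_add]
  intro z
  constructor
  · intro hz
    have := key z
    rw [hz, map_zero] at this
    exact (Submodule.Quotient.mk_eq_zero P).1 this.symm
  · rintro ⟨y, rfl⟩
    induction y using TensorProduct.induction_on with
    | zero => simp
    | tmul a m =>
      rw [resolutionTwo_tmul, map_smul, resolutionOne_derivation, ← hF, hF0]
      simp
    | add y z hy hz => rw [map_add, map_add, hy, hz, add_zero]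

end Relation

/-! ### Injectivity of the left map -/

section Injective

variable {k : Type u} [Field k] {V : Type v} [AddCommGroup V] [Module k V] {N n : ℕ}

theorem wordRank_mul_lt_mul {a a' t t' : FreeMonoid (Fin n)} (ha : wordRank a ≤ wordRank a')
    (ht : wordRank t < wordRank t') : wordRank (a * t) < wordRank (a' * t') := by
  refine (wordRank_mul_lt_mul_left a ht).trans_le ?_
  rcases ha.eq_or_lt with h | h
  · rw [wordRank_injective h]
  · exact (wordRank_mul_lt_mul_right t' h).le

theorem exists_mul_of {t : FreeMonoid (Fin n)} (ht : t ≠ 1) :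
    ∃ t' y, t = t' * FreeMonoid.of y := by
  rcases List.eq_nil_or_concat t.toList with h | ⟨l, y, h⟩
  · exact absurd (FreeMonoid.toList.injective h) ht
  · exact ⟨FreeMonoid.ofList l, y, FreeMonoid.toList.injective (by
      simpa [FreeMonoid.toList_mul, FreeMonoid.toList_of] using h)⟩

variable (b : Module.Basis (Fin n) k V) (R : Submodule k ((⨂[k]^N) V))
  {M : Type w} [AddCommGroup M] [Module k M] [Module (Alg R) M] [IsScalarTower k (Alg R) M]

theorem derivation_basis_mul_of (t : FreeMonoid (Fin n)) (y : Fin n) (m : M) :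
    derivation R M (b.tensorAlgebra (t * FreeMonoid.of y)) m =
      Alg.mk R (b.tensorAlgebra t) ⊗ₜ (b y ⊗ₜ m) +
        derivation R M (b.tensorAlgebra t) (Alg.mk R (TensorAlgebra.ι k (b y)) • m) := by
  rw [tensorAlgebra_basis_mul, derivation_mul, tensorAlgebra_basis_of, derivation_ι,
    TensorProduct.smul_tmul', smul_eq_mul, mul_one]

/-- In each Leibniz term the factor in `A` is the part of `t` before some letter. -/
theorem derivation_basis_mem_span (t : FreeMonoid (Fin n)) (m : M) :
    derivation R M (b.tensorAlgebra t) m ∈ Submodule.span k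
      {e | ∃ t' : FreeMonoid (Fin n), t'.toList.length < t.toList.length ∧
        ∃ p : V ⊗[k] M, e = Alg.mk R (b.tensorAlgebra t') ⊗ₜ p} := by
  induction h : t.toList.length generalizing t m with
  | zero =>
    obtain rfl : t = 1 := FreeMonoid.toList.injective (List.length_eq_zero_iff.1 h)
    rw [tensorAlgebra_basis_one, derivation_one]
    exact zero_mem _
  | succ l ih =>
    obtain ⟨t', y, rfl⟩ := exists_mul_of (t := t) (by rintro rfl; simp at h)
    have hl : t'.toList.length = l := by
      simpa [FreeMonoid.toList_mul, FreeMonoid.toList_of] using h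
    rw [derivation_basis_mul_of]
    refine add_mem (Submodule.subset_span ⟨t', by omega, _, rfl⟩) ?_
    refine Submodule.span_mono ?_ (ih t' _ hl)
    rintro _ ⟨t'', h, p, rfl⟩
    exact ⟨t'', by omega, p, rfl⟩

variable {b R} {f : (⨂[k]^N) V} {s : FreeMonoid (Fin n)}

/-- Spanning by normal words suffices; their independence enters `resolutionTwo_injective` through a
functional. -/
theorem exists_finsupp_isNormal (hf : HasLead b (TensorPower.toTensorAlgebra f) s)
    (hR : R = Submodule.span k {f}) (z : Alg R ⊗[k] M) :
    ∃ c : {a // IsNormal s a} →₀ M,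
      z = c.sum fun a m => Alg.mk R (b.tensorAlgebra a) ⊗ₜ m := by
  let L : ({a // IsNormal s a} →₀ M) →ₗ[k] Alg R ⊗[k] M :=
    Finsupp.lsum k fun a => TensorProduct.mk k (Alg R) M (Alg.mk R (b.tensorAlgebra a))
  suffices h : z ∈ LinearMap.range L by
    obtain ⟨c, rfl⟩ := h
    exact ⟨c, rfl⟩
  induction z using TensorProduct.induction_on with
  | zero => exact zero_mem _
  | tmul a m =>
    have ha : a ∈ Submodule.span k (Set.range fun a : {a // IsNormal s a} =>
        Alg.mk R (b.tensorAlgebra a)) := by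
      subst hR
      rw [span_isNormal hf]
      trivial
    induction ha using Submodule.span_induction with
    | mem a ha =>
      obtain ⟨a, rfl⟩ := ha
      exact ⟨Finsupp.single a m, by simp [L]⟩
    | zero => rw [TensorProduct.zero_tmul]; exact zero_mem _
    | add x y _ _ hx hy => rw [TensorProduct.add_tmul]; exact add_mem hx hy
    | smul c x _ hx => rw [← TensorProduct.smul_tmul']; exact Submodule.smul_mem _ _ hx
  | add x y hx hy => exact add_mem hx hy

/-- Write `s = s' x`, and let `a` be the largest normal word with nonzero coefficient in an element
of the kernel. In the image, `a s' ⊗ x` is the largest contribution ending in `x`, and `a s'` is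
still normal as `s` has no repeated letters. So the coefficient of `a` must vanish. -/
theorem resolutionTwo_injective (hf : HasLead b (TensorPower.toTensorAlgebra f) s)
    (hs : s ≠ 1) (hs' : s.toList.Nodup) (hR : R = Submodule.span k {f}) :
    Function.Injective (resolutionTwo R M f) := by
  rw [injective_iff_map_eq_zero]
  intro z hz
  obtain ⟨c, rfl⟩ := exists_finsupp_isNormal hf hR z
  rcases eq_or_ne c 0 with rfl | hc
  · simp
  exfalso
  obtain ⟨a, ha, hmax⟩ := Finset.exists_max_image _ (fun a => wordRank a.1)
    (Finsupp.support_nonempty_iff.2 hc)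
  obtain ⟨s', x, rfl⟩ := exists_mul_of hs
  obtain ⟨φ, hφ, hφ0⟩ : ∃ φ : Alg R →ₗ[k] k,
      φ (Alg.mk _ (b.tensorAlgebra (a * s'))) ≠ 0 ∧
      ∀ y ∈ lowerSpan b (a * s'), φ (Alg.mk _ y) = 0 := by
    subst hR
    exact exists_dual_of_isNormal hf hs hs' (a.2.mul_of_nodup hs')
  obtain ⟨e, he, hl⟩ := hf
  -- Isolates the coefficient of `a s' ⊗ x`: `φ` kills every word below `a s'`, and the coordinate
  -- kills every last letter other than `x`.
  let Φ : Alg R ⊗[k] (V ⊗[k] M) →ₗ[k] M :=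
    (TensorProduct.lid k M).toLinearMap ∘ₗ TensorProduct.map φ
      ((TensorProduct.lid k M).toLinearMap ∘ₗ TensorProduct.map (b.coord x) LinearMap.id)
  have hΦ : ∀ (p : Alg R) (v : V) (m : M), Φ (p ⊗ₜ (v ⊗ₜ m)) = φ p • b.coord x v • m := by
    intro p v m
    simp [Φ, smul_comm (φ p)]
  have hΦ0 : ∀ (p : Alg R) (q : V ⊗[k] M), φ p = 0 → Φ (p ⊗ₜ q) = 0 := by
    intro p q h
    simp [Φ, h]
  -- terms whose first factor is short do not contribute
  have hshort : ∀ (d t : FreeMonoid (Fin n)) (m : M), wordRank d ≤ wordRank a.1 →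
      t.toList.length ≤ s'.toList.length →
      Φ (Alg.mk R (b.tensorAlgebra d) • derivation R M (b.tensorAlgebra t) m) = 0 := by
    intro d t m hd ht
    have h := derivation_basis_mem_span b R t m
    generalize derivation R M (b.tensorAlgebra t) m = D at h
    induction h using Submodule.span_induction with
    | mem y hy =>
      obtain ⟨t', ht', p, rfl⟩ := hy
      rw [TensorProduct.smul_tmul', smul_eq_mul, ← map_mul, ← tensorAlgebra_basis_mul]
      exact hΦ0 _ _ (hφ0 _ (basis_mem_lowerSpan
        (wordRank_mul_lt_mul hd (wordRank_lt_of_length_lt (by omega)))))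
    | zero => simp
    | add y z _ _ hy hz => rw [smul_add, map_add, hy, hz, add_zero]
    | smul r y _ hy => rw [smul_comm, map_smul, hy, smul_zero]
  have hmain : ∀ (d t : FreeMonoid (Fin n)) (y : Fin n) (m : M), wordRank d ≤ wordRank a.1 →
      t.toList.length ≤ s'.toList.length →
      Φ (Alg.mk R (b.tensorAlgebra d) •
        derivation R M (b.tensorAlgebra (t * FreeMonoid.of y)) m) =
        φ (Alg.mk R (b.tensorAlgebra (d * t))) • b.coord x (b y) • m := by
    intro d t y m hd ht
    rw [derivation_basis_mul_of, smul_add, map_add, hshort d t _ hd ht, add_zero,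
      TensorProduct.smul_tmul', smul_eq_mul, ← map_mul, ← tensorAlgebra_basis_mul, hΦ]
  have hlower : ∀ (d : FreeMonoid (Fin n)) (m : M), wordRank d ≤ wordRank a.1 →
      ∀ r ∈ lowerSpan b (s' * FreeMonoid.of x),
      Φ (Alg.mk R (b.tensorAlgebra d) • derivation R M r m) = 0 := by
    intro d m hd r hr
    induction hr using Submodule.span_induction with
    | mem y hy =>
      obtain ⟨t, ht, rfl⟩ := hy
      replace ht : wordRank t < wordRank (s' * FreeMonoid.of x) := ht
      rcases eq_or_ne t 1 with rfl | h1
      · rw [tensorAlgebra_basis_one, derivation_one, smul_zero, map_zero]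
      obtain ⟨t, y, rfl⟩ := exists_mul_of h1
      have hlen := length_le_of_wordRank_le (le_of_lt ht)
      simp only [FreeMonoid.toList_mul, FreeMonoid.toList_of, List.length_append,
        List.length_singleton, add_le_add_iff_right] at hlen
      rw [hmain d t y m hd hlen]
      rcases eq_or_ne y x with rfl | hy
      · have hlt : wordRank t < wordRank s' := by
          by_contra! h
          rcases h.eq_or_lt with h | h
          · rw [wordRank_injective h] at ht
            exact lt_irrefl _ ht
          · exact lt_asymm ht (wordRank_mul_lt_mul_right _ h)
        rw [hφ0 _ (basis_mem_lowerSpan (wordRank_mul_lt_mul hd hlt)), zero_smul]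
      · rw [b.coord_apply, b.repr_self, Finsupp.single_eq_of_ne (Ne.symm hy), zero_smul,
          smul_zero]
    | zero => simp
    | add y z _ _ hy hz => rw [map_add, LinearMap.add_apply, smul_add, map_add, hy, hz, add_zero]
    | smul r y _ hy =>
      rw [map_smul (derivation R M), LinearMap.smul_apply, smul_comm, map_smul, hy, smul_zero]
  have hfinal : ∀ (d : FreeMonoid (Fin n)) (m : M), wordRank d ≤ wordRank a.1 →
      Φ (resolutionTwo R M f (Alg.mk R (b.tensorAlgebra d) ⊗ₜ m)) =
        (e * φ (Alg.mk R (b.tensorAlgebra (d * s')))) • m := by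
    intro d m hd
    rw [resolutionTwo_tmul,
      ← sub_add_cancel (TensorPower.toTensorAlgebra f) (e • b.tensorAlgebra (s' * .of x)),
      map_add, LinearMap.add_apply, smul_add, map_add, hlower d m hd _ hl, zero_add, map_smul (derivation R M),
      LinearMap.smul_apply, smul_comm, map_smul, hmain d s' x m hd le_rfl]
    simp [mul_smul]
  have h0 := congrArg Φ hz
  rw [Finsupp.sum, map_sum, map_sum, map_zero, Finset.sum_eq_single_of_mem a ha, hfinal _ _ le_rfl]
    at h0
  · rw [smul_eq_zero] at h0
    exact h0.elim (mul_ne_zero he hφ) (Finsupp.mem_support_iff.1 ha)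
  · intro d hd hda
    have hlt : wordRank d.1 < wordRank a.1 :=
      lt_of_le_of_ne (hmax d hd) fun h => hda (Subtype.ext (wordRank_injective h))
    rw [hfinal _ _ hlt.le, hφ0 _ (basis_mem_lowerSpan (wordRank_mul_lt_mul_right s' hlt)),
      mul_zero, zero_smul]

end Injective

/-! ### Dimension shifting along a resolution of length two -/

section ProjectiveDimension

open CategoryTheory

variable {A : Type w} [Ring A] {M P₀ P₁ P₂ : Type w} [AddCommGroup M] [AddCommGroup P₀]
  [AddCommGroup P₁] [AddCommGroup P₂] [Module A M] [Module A P₀] [Module A P₁] [Module A P₂]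
  {d₂ : P₂ →ₗ[A] P₁} {d₁ : P₁ →ₗ[A] P₀} {d₀ : P₀ →ₗ[A] M}

/-- Cuts the resolution at the first syzygy into short exact sequences. -/
theorem exact_codRestrict_ker (h₂₁ : Function.Exact d₂ d₁) (h₁₀ : Function.Exact d₁ d₀) :
    ∃ g : P₁ →ₗ[A] LinearMap.ker d₀, Function.Surjective g ∧ Function.Exact d₂ g := by
  refine ⟨d₁.codRestrict (LinearMap.ker d₀) fun x => h₁₀.apply_apply_eq_zero x, ?_, ?_⟩
  · rintro ⟨y, hy⟩
    obtain ⟨x, rfl⟩ := (h₁₀ y).1 hy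
    exact ⟨x, rfl⟩
  · intro x
    rw [← h₂₁ x]
    exact Subtype.ext_iff

/-- A module with a projective resolution of length two has projective dimension at most two. -/
theorem hasProjectiveDimensionLT_three [Module.Projective A P₀] [Module.Projective A P₁]
    [Module.Projective A P₂]
    (h₂ : Function.Injective d₂) (h₂₁ : Function.Exact d₂ d₁)
    (h₁₀ : Function.Exact d₁ d₀) (h₀ : Function.Surjective d₀) :
    HasProjectiveDimensionLT (ModuleCat.of A M) 3 := by
  obtain ⟨g, hg, hex⟩ := exact_codRestrict_ker h₂₁ h₁₀
  have hP₂ := (IsProjective.iff_projective (R := A) P₂).1 inferInstance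
  have hP₁ := (IsProjective.iff_projective (R := A) P₁).1 inferInstance
  have hP₀ := (IsProjective.iff_projective (R := A) P₀).1 inferInstance
  have hS : (ModuleCat.shortComplexOfCompEqZero d₂ g hex.linearMap_comp_eq_zero).ShortExact :=
    ModuleCat.shortComplex_shortExact _ hex h₂ hg
  refine ((LinearMap.shortExact_shortComplexKer h₀).hasProjectiveDimensionLT_X₃_iff 1 hP₀).2 ?_
  refine (hS.hasProjectiveDimensionLT_X₃_iff 0 hP₁).2 ?_
  exact projective_iff_hasProjectiveDimensionLT_one.1 hP₂

/-- If the projective dimension is at most one, then a resolution of length two splits. -/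
theorem exists_retraction_of_hasProjectiveDimensionLT_two
    [Module.Projective A P₀] (h₂ : Function.Injective d₂) (h₂₁ : Function.Exact d₂ d₁)
    (h₁₀ : Function.Exact d₁ d₀) (h₀ : Function.Surjective d₀)
    (h : HasProjectiveDimensionLT (ModuleCat.of A M) 2) :
    ∃ ρ : P₁ →ₗ[A] P₂, ρ ∘ₗ d₂ = LinearMap.id := by
  obtain ⟨g, hg, hex⟩ := exact_codRestrict_ker h₂₁ h₁₀
  have hP₀ := (IsProjective.iff_projective (R := A) P₀).1 inferInstance
  -- The first syzygy is projective, so the surjection from `P₁` onto it splits.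
  have h' := ((LinearMap.shortExact_shortComplexKer h₀).hasProjectiveDimensionLT_X₃_iff 0 hP₀).1 h
  have h'' : Module.Projective A (LinearMap.ker d₀) :=
    (IsProjective.iff_projective _).2 (projective_iff_hasProjectiveDimensionLT_one.2 h')
  obtain ⟨σ, hσ⟩ := Module.projective_lifting_property g LinearMap.id hg
  exact ((hex.split_tfae'.out 0 1 rfl rfl).1 ⟨h₂, σ, hσ⟩).2

end ProjectiveDimension

/-! ### The trivial module -/

section Trivial

variable {k : Type u} [Field k] {V : Type v} [AddCommGroup V] [Module k V] {N n : ℕ}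
  (R : Submodule k ((⨂[k]^N) V))

theorem algebraMapInv_eq_zero_of_mem_tpow {m : ℕ} (hm : m ≠ 0) {x : TensorAlgebra k V}
    (hx : x ∈ tpow k V m) : TensorAlgebra.algebraMapInv x = 0 := by
  obtain ⟨m, rfl⟩ := Nat.exists_eq_succ_of_ne_zero hm
  rw [tpow, pow_succ] at hx
  refine Submodule.mul_induction_on hx ?_ fun x y hx hy => by rw [map_add, hx, hy, add_zero]
  rintro x - _ ⟨v, rfl⟩
  simp [TensorAlgebra.algebraMapInv]

/-- The augmentation `A → k`. -/
def augmentation (hN : N ≠ 0) : Alg R →ₐ[k] k :=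
  Ideal.Quotient.liftₐ (relIdeal R) TensorAlgebra.algebraMapInv fun x hx => by
    have hx' : x ∈ TwoSidedIdeal.span (rel R : Set (TensorAlgebra k V)) := hx
    clear hx
    induction hx' using TwoSidedIdeal.span_induction with
    | mem x hx => exact algebraMapInv_eq_zero_of_mem_tpow hN (rel_le R hx)
    | zero => simp
    | add x y _ _ hx hy => rw [map_add, hx, hy, add_zero]
    | neg x _ hx => rw [map_neg, hx, neg_zero]
    | left_absorb a x _ hx => rw [map_mul, hx, mul_zero]
    | right_absorb a x _ hx => rw [map_mul, hx, zero_mul]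

theorem augmentation_mk (hN : N ≠ 0) (x : TensorAlgebra k V) :
    augmentation R hN (Alg.mk R x) = TensorAlgebra.algebraMapInv x := rfl

/-- The trivial one-dimensional `A`-module. -/
def TrivialModule (_ : Submodule k ((⨂[k]^N) V)) (_ : N ≠ 0) : Type (max u v) := ULift.{v} k

namespace TrivialModule

variable {R} {hN : N ≠ 0}

instance : AddCommGroup (TrivialModule R hN) := inferInstanceAs (AddCommGroup (ULift.{v} k))

instance : Module k (TrivialModule R hN) := inferInstanceAs (Module k (ULift.{v} k))

instance : Module (Alg R) (TrivialModule R hN) :=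
  Module.compHom (TrivialModule R hN) (augmentation R hN).toRingHom

theorem alg_smul_def (a : Alg R) (m : TrivialModule R hN) : a • m = augmentation R hN a • m := rfl

instance : IsScalarTower k (Alg R) (TrivialModule R hN) where
  smul_assoc c a m := by
    rw [alg_smul_def, alg_smul_def, map_smul, smul_assoc]

variable (R hN) in
/-- The trivial module is one-dimensional. -/
def equiv : TrivialModule R hN ≃ₗ[k] k := ULift.moduleEquiv

theorem mk_smul_eq_zero {m : ℕ} (hm : m ≠ 0) {x : TensorAlgebra k V} (hx : x ∈ tpow k V m)
    (y : TrivialModule R hN) : Alg.mk R x • y = 0 := by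
  rw [alg_smul_def, augmentation_mk, algebraMapInv_eq_zero_of_mem_tpow hm hx, zero_smul]

end TrivialModule

theorem tpow_one : tpow k V 1 = LinearMap.range (TensorAlgebra.ι k : V →ₗ[k] _) :=
  pow_one _

theorem exists_sum_mul_ι (b : Module.Basis (Fin n) k V) {m : ℕ} {x : TensorAlgebra k V}
    (hx : x ∈ tpow k V (m + 1)) :
    ∃ g : Fin n → tpow k V m, x = ∑ j, (g j : TensorAlgebra k V) * TensorAlgebra.ι k (b j) := by
  rw [tpow, pow_succ] at hx
  induction hx using Submodule.mul_induction_on' with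
  | mem_mul_mem x hx y hy =>
    obtain ⟨v, rfl⟩ := hy
    refine ⟨fun j => b.repr v j • ⟨x, hx⟩, ?_⟩
    conv_lhs => rw [← b.sum_repr v, map_sum, Finset.mul_sum]
    simp
  | add x _ y _ hx hy =>
    obtain ⟨g, rfl⟩ := hx
    obtain ⟨h, rfl⟩ := hy
    exact ⟨g + h, by simp [add_mul, Finset.sum_add_distrib]⟩

/-- Letters act by zero here, so only the Leibniz term that singles out the last letter survives.
This turns the derivative of `f` into the Koszul differential. -/
theorem derivation_trivialModule {hN : N ≠ 0} (b : Module.Basis (Fin n) k V)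
    (g : Fin n → TensorAlgebra k V) (m : TrivialModule R hN) :
    derivation R (TrivialModule R hN) (∑ j, g j * TensorAlgebra.ι k (b j)) m =
      ∑ j, Alg.mk R (g j) ⊗ₜ (b j ⊗ₜ m) := by
  rw [map_sum, LinearMap.sum_apply]
  refine Finset.sum_congr rfl fun j _ => ?_
  rw [derivation_mul, derivation_ι, TensorProduct.smul_tmul', smul_eq_mul, mul_one,
    TrivialModule.mk_smul_eq_zero one_ne_zero (by rw [tpow_one]; exact ⟨_, rfl⟩), map_zero,
    add_zero]

end Trivial

/-! ### Global dimension -/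

section GlobalDimension

open CategoryTheory

variable {k : Type u} [Field k] {V : Type v} [AddCommGroup V] [Module k V] {N n : ℕ}
  {b : Module.Basis (Fin n) k V} {f : (⨂[k]^N) V} {s : FreeMonoid (Fin n)}
  {R : Submodule k ((⨂[k]^N) V)}

theorem toTensorAlgebra_mem_tpow (f : (⨂[k]^N) V) :
    TensorPower.toTensorAlgebra f ∈ tpow k V N := by
  rw [← range_toTensorAlgebra]
  exact ⟨f, rfl⟩

theorem globalDimension_eq_two (hf : HasLead b (TensorPower.toTensorAlgebra f) s)
    (hs : s ≠ 1) (hs' : s.toList.Nodup) (hR : R = Submodule.span k {f}) (hN : 2 ≤ N) :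
    globalDimension (Alg R) = 2 := by
  apply le_antisymm
  · refine iSup_le fun M => ?_
    refine (projectiveDimension_le_iff M 2).2 ?_
    -- Over a field `M` and `V ⊗ M` are free, so the terms of the resolution are free over `A`.
    let : Module k M := Module.compHom M (algebraMap k (Alg R))
    have : IsScalarTower k (Alg R) M := ⟨fun c a m => by
      rw [Algebra.smul_def, mul_smul]; rfl⟩
    exact hasProjectiveDimensionLT_three (resolutionTwo_injective (M := M) hf hs hs' hR)
      (exact_resolutionTwo_resolutionOne hR) (exact_resolutionOne_resolutionZero R)
      (resolutionZero_surjective R)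
  · have hN0 : N ≠ 0 := by omega
    refine le_trans ?_ (le_iSup _ (ModuleCat.of (Alg R) (TrivialModule R hN0)))
    refine (projectiveDimension_ge_iff _ 2).2 fun h => ?_
    obtain ⟨ρ, hρ⟩ := exists_retraction_of_hasProjectiveDimensionLT_two
      (resolutionTwo_injective (M := TrivialModule R hN0) hf hs hs' hR)
      (exact_resolutionTwo_resolutionOne hR) (exact_resolutionOne_resolutionZero R)
      (resolutionZero_surjective R) h
    obtain ⟨N, rfl⟩ := Nat.exists_eq_succ_of_ne_zero hN0
    obtain ⟨g, hg⟩ := exists_sum_mul_ι b (toTensorAlgebra_mem_tpow f)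
    have h0 : ∀ m : TrivialModule R hN0, m = 0 := by
      intro m
      have h1 := LinearMap.congr_fun hρ (1 ⊗ₜ m)
      rw [LinearMap.comp_apply, resolutionTwo_tmul, one_smul, hg, derivation_trivialModule,
        LinearMap.id_apply] at h1
      -- By `A`-linearity the retraction gives `1 ⊗ m = ∑ g_j ρ(1 ⊗ b_j ⊗ m)`. The `g_j` have degree
      -- `N - 1 ≥ 1`, so they act by zero after augmentation, and `m = 0`.
      have h2 := congrArg (resolutionZero R (TrivialModule R hN0)) h1
      rw [resolutionZero_tmul, one_smul, map_sum, map_sum] at h2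
      rw [← h2]
      refine Finset.sum_eq_zero fun j _ => ?_
      rw [← mul_one (Alg.mk R (g j : TensorAlgebra k V)), ← smul_eq_mul,
        ← TensorProduct.smul_tmul', map_smul, map_smul]
      exact TrivialModule.mk_smul_eq_zero (by omega) (g j).2 _
    have := h0 ((TrivialModule.equiv R hN0).symm 1)
    simp at this

end GlobalDimension

/-! ### The Koszul complex -/

section Koszul

variable {k : Type u} [Field k] {V : Type v} [AddCommGroup V] [Module k V] {N n : ℕ}
  {b : Module.Basis (Fin n) k V} {f : (⨂[k]^N) V} {s : FreeMonoid (Fin n)}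
  {R : Submodule k ((⨂[k]^N) V)}

theorem tpow_zero : tpow k V 0 = 1 :=
  pow_zero _

theorem mem_W_of_lt {m : ℕ} (hm : m < N) {x : TensorAlgebra k V} :
    x ∈ W R m ↔ x ∈ tpow k V m := by
  simp only [W, Submodule.mem_inf, Submodule.mem_iInf, and_iff_left_iff_imp]
  intros
  omega

theorem W_self : W R N = rel R := by
  ext x
  simp only [W, Submodule.mem_inf, Submodule.mem_iInf]
  constructor
  · intro h
    simpa [tpow_zero] using h.2 0 0 (by omega)
  · refine fun h => ⟨rel_le R h, fun i j hij => ?_⟩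
    obtain ⟨rfl, rfl⟩ : i = 0 ∧ j = 0 := by omega
    simpa [tpow_zero] using h

/-- The intersections of `R ⊗ V^{⊗ m}` and `V^{⊗ m} ⊗ R` vanish if the leading word of `f` has no
repeated letters. -/
theorem rel_mul_tpow_inf_tpow_mul_rel (hf : HasLead b (TensorPower.toTensorAlgebra f) s)
    (hs : s.toList.Nodup) (hR : R = Submodule.span k {f}) {m : ℕ} (hm : m ≠ 0) (hmN : m < N) :
    (rel R * tpow k V m) ⊓ (tpow k V m * rel R) = ⊥ := by
  rw [hR, rel_span_singleton, eq_bot_iff]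
  rintro x ⟨hx, hx'⟩
  obtain ⟨y, hy, rfl⟩ := Submodule.mem_span_singleton_mul.1 hx
  obtain ⟨z, hz, hyz⟩ := Submodule.mem_mul_span_singleton.1 hx'
  rw [Submodule.mem_bot]
  by_contra h0
  obtain ⟨t, ht, -⟩ := exists_hasLead (b := b) (right_ne_zero_of_mul h0)
  obtain ⟨t', ht', ht0⟩ := exists_hasLead (b := b) (x := z) (by rintro rfl; simp_all)
  have hlen := length_eq_of_mem_tpow b hz ht0
  have hlen' := length_eq_of_mem_tpow b (toTensorAlgebra_mem_tpow f) hf.repr_ne_zero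
  have h1 := hf.mul ht
  rw [← hyz] at h1
  -- The two leading words agree: `s t = t' s` with `t'` of length `m`, where `0 < m < N`. This is a
  -- self-overlap of `s`.
  exact mul_ne_mul_of_nodup hs (by omega) (by omega) (h1.unique (ht'.mul hf))

/-- The intersection for `m = 1` already contains `W_{N+1}`, and all later `W_m` lie in `V^{⊗
(m-N-1)} ⊗ W_{N+1}`. -/
theorem W_eq_bot (h : (rel R * tpow k V 1) ⊓ (tpow k V 1 * rel R) = ⊥) {m : ℕ} (hm : N < m) :
    W R m = ⊥ := by
  have h1 : W R (N + 1) = ⊥ := by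
    rw [eq_bot_iff, ← h]
    intro x hx
    simp only [W, Submodule.mem_inf, Submodule.mem_iInf] at hx
    have h01 := hx.2 0 1 (by omega)
    have h10 := hx.2 1 0 (by omega)
    rw [tpow_zero, one_mul] at h01
    rw [tpow_zero, mul_one] at h10
    exact ⟨h01, h10⟩
  have := W_le R (Nat.succ_le_of_lt hm)
  rwa [Nat.succ_eq_add_one, h1, Submodule.mul_bot, le_bot_iff] at this

/-- Sums are needed because `f` is not a single product, and its summands need not lie in `W_q`. -/
theorem inclW_sum {ι : Type*} [Fintype ι] {p q : ℕ} (hpq : p ≤ q) (u : ι → tpow k V (q - p))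
    (y : ι → W R p) (x : W R q)
    (h : (x : TensorAlgebra k V) = ∑ j, (u j : TensorAlgebra k V) * y j) :
    inclW R hpq x = ∑ j, u j ⊗ₜ y j := by
  unfold inclW
  rw [LinearMap.comp_apply, LinearEquiv.coe_coe, LinearEquiv.symm_apply_eq]
  apply Subtype.ext
  rw [map_sum, Submodule.coe_inclusion, h]
  simp [Submodule.LinearDisjoint.val_mulMap_tmul]

theorem differential_tmul {ι : Type*} [Fintype ι] (hN : 2 ≤ N) (i : ℕ) (a : Alg R)
    (u : ι → tpow k V (nu N (i + 1) - nu N i)) (y : ι → W R (nu N i)) (x : W R (nu N (i + 1)))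
    (h : (x : TensorAlgebra k V) = ∑ j, (u j : TensorAlgebra k V) * y j) :
    differential R hN i (a ⊗ₜ x) = ∑ j, (a * Alg.mk R (u j : TensorAlgebra k V)) ⊗ₜ y j := by
  unfold differential
  rw [TensorProduct.AlgebraTensorModule.lift_tmul, LinearMap.toSpanSingleton_apply,
    LinearMap.smul_apply, LinearMap.comp_apply, inclW_sum _ u y x h, map_sum, Finset.smul_sum]
  refine Finset.sum_congr rfl fun j _ => ?_
  rw [LinearMap.rTensor_tmul, TensorProduct.smul_tmul']
  rfl

theorem nu_zero : nu N 0 = 0 := by simp [nu]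

theorem nu_one : nu N 1 = 1 := by simp [nu]

theorem nu_two : nu N 2 = N := by simp [nu]

theorem lt_nu (hN : 2 ≤ N) {i : ℕ} (hi : 3 ≤ i) : N < nu N i := by
  unfold nu
  rcases hi.eq_or_lt with rfl | hi
  · norm_num
  · have h : N * 2 ≤ N * (i / 2) := Nat.mul_le_mul_left _ (by omega)
    omega

theorem subsingleton_K (hN : 2 ≤ N) (h : (rel R * tpow k V 1) ⊓ (tpow k V 1 * rel R) = ⊥)
    {i : ℕ} (hi : 3 ≤ i) : Subsingleton (K R i) := by
  have : Subsingleton (W R (nu N i)) := by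
    rw [W_eq_bot h (lt_nu hN hi)]
    infer_instance
  infer_instance

variable (R) in
/-- The isomorphism `k ≅ W_0`. -/
def equivWZero (hN : 2 ≤ N) : k ≃ₗ[k] W R (nu N 0) :=
  LinearEquiv.ofBijective ((LinearMap.toSpanSingleton k (TensorAlgebra k V) 1).codRestrict _
    fun c => by
      rw [nu_zero, mem_W_of_lt (by omega), tpow_zero, LinearMap.toSpanSingleton_apply]
      exact Submodule.smul_mem _ _ (Submodule.one_le.1 le_rfl)) <| by
    constructor
    · intro c d h
      have h' : c • (1 : TensorAlgebra k V) = d • 1 := congrArg Subtype.val h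
      rwa [← Algebra.algebraMap_eq_smul_one, ← Algebra.algebraMap_eq_smul_one,
        TensorAlgebra.algebraMap_inj] at h'
    · rintro ⟨x, hx⟩
      have hx' := hx
      rw [nu_zero, mem_W_of_lt (by omega), tpow_zero, Submodule.mem_one] at hx'
      obtain ⟨c, rfl⟩ := hx'
      exact ⟨c, Subtype.ext (Algebra.algebraMap_eq_smul_one c).symm⟩

@[simp]
theorem coe_equivWZero (hN : 2 ≤ N) (c : k) :
    (equivWZero R hN c : TensorAlgebra k V) = c • 1 := rfl

variable (R) in
/-- The isomorphism `V ≅ W_1`. -/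
def equivWOne (hN : 2 ≤ N) : V ≃ₗ[k] W R (nu N 1) :=
  LinearEquiv.ofBijective ((TensorAlgebra.ι k : V →ₗ[k] TensorAlgebra k V).codRestrict _
    fun v => by
      rw [nu_one, mem_W_of_lt (by omega), tpow_one]
      exact ⟨v, rfl⟩) <| by
    constructor
    · intro x y h
      exact TensorAlgebra.ι_leftInverse.injective (congrArg Subtype.val h)
    · rintro ⟨x, hx⟩
      have hx' := hx
      rw [nu_one, mem_W_of_lt (by omega), tpow_one] at hx'
      obtain ⟨v, rfl⟩ := hx'
      exact ⟨v, rfl⟩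

@[simp]
theorem coe_equivWOne (hN : 2 ≤ N) (v : V) :
    (equivWOne R hN v : TensorAlgebra k V) = TensorAlgebra.ι k v := rfl

/-- The isomorphism `k ≅ W_N` given by the generator of `R`. -/
def equivWTwo (hR : R = Submodule.span k {f}) (hf : f ≠ 0) : k ≃ₗ[k] W R (nu N (1 + 1)) :=
  LinearEquiv.ofBijective
    ((LinearMap.toSpanSingleton k (TensorAlgebra k V) (TensorPower.toTensorAlgebra f)).codRestrict
      _ fun c => by
        rw [show nu N (1 + 1) = N from nu_two, W_self, hR, rel_span_singleton]
        exact Submodule.smul_mem _ _ (Submodule.mem_span_singleton_self _)) <| by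
    constructor
    · intro c d h
      have h' : c • TensorPower.toTensorAlgebra f = d • TensorPower.toTensorAlgebra f :=
        congrArg Subtype.val h
      refine smul_left_injective k (fun h0 => hf ?_) h'
      exact toTensorAlgebra_injective k V N (by rw [h0, map_zero])
    · rintro ⟨x, hx⟩
      have hx' := hx
      rw [show nu N (1 + 1) = N from nu_two, W_self, hR, rel_span_singleton] at hx'
      obtain ⟨c, rfl⟩ := Submodule.mem_span_singleton.1 hx'
      exact ⟨c, rfl⟩

@[simp]
theorem coe_equivWTwo (hR : R = Submodule.span k {f}) (hf : f ≠ 0) (c : k) :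
    (equivWTwo hR hf c : TensorAlgebra k V) = c • TensorPower.toTensorAlgebra f := rfl

/-- The terms of degree at most two of the Koszul complex form the resolution of the trivial
module. -/
theorem differential_exact_and_injective (hf : HasLead b (TensorPower.toTensorAlgebra f) s)
    (hs : s ≠ 1) (hs' : s.toList.Nodup) (hR : R = Submodule.span k {f}) (hf0 : f ≠ 0)
    (hN : 2 ≤ N) :
    Function.Exact (differential R hN 1) (differential R hN 0) ∧
      Function.Injective (differential R hN 1) := by
  have hN0 : N ≠ 0 := by omega
  let M := TrivialModule R hN0
  let ε : M ≃ₗ[k] k := TrivialModule.equiv R hN0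
  let e₀ : Alg R ⊗[k] M ≃ₗ[Alg R] K R 0 :=
    TensorProduct.AlgebraTensorModule.congr (LinearEquiv.refl _ _) (ε.trans (equivWZero R hN))
  let e₁ : Alg R ⊗[k] (V ⊗[k] M) ≃ₗ[Alg R] K R 1 :=
    TensorProduct.AlgebraTensorModule.congr (LinearEquiv.refl _ _)
      (((TensorProduct.congr (LinearEquiv.refl k V) ε).trans (TensorProduct.rid k V)).trans
        (equivWOne R hN))
  let e₂ : Alg R ⊗[k] M ≃ₗ[Alg R] K R (1 + 1) :=
    TensorProduct.AlgebraTensorModule.congr (LinearEquiv.refl _ _) (ε.trans (equivWTwo hR hf0))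
  have he₁ : ∀ (a : Alg R) (v : V) (m : M),
      e₁ (a ⊗ₜ (v ⊗ₜ m)) = a ⊗ₜ (equivWOne R hN (ε m • v)) := fun a v m => rfl
  have he₂ : ∀ (a : Alg R) (m : M), e₂ (a ⊗ₜ m) = a ⊗ₜ (equivWTwo hR hf0 (ε m)) :=
    fun a m => rfl
  have h₂₁ : differential R hN 1 ∘ₗ e₂.toLinearMap =
      e₁.toLinearMap ∘ₗ resolutionTwo R M f := by
    obtain ⟨g, hg⟩ := exists_sum_mul_ι b (m := N - 1) (x := TensorPower.toTensorAlgebra f) (by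
      rw [Nat.sub_add_cancel (by omega)]; exact toTensorAlgebra_mem_tpow f)
    refine TensorProduct.AlgebraTensorModule.ext fun a m => ?_
    rw [LinearMap.comp_apply, LinearMap.comp_apply, LinearEquiv.coe_coe, LinearEquiv.coe_coe,
      resolutionTwo_tmul, hg, derivation_trivialModule, map_smul, map_sum, Finset.smul_sum, he₂]
    rw [differential_tmul hN 1 a
      (fun j => ⟨g j, by rw [show nu N (1 + 1) = N from nu_two, nu_one]; exact (g j).2⟩)
      (fun j => equivWOne R hN (ε m • b j))]
    · refine Finset.sum_congr rfl fun j _ => ?_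
      rw [he₁, TensorProduct.smul_tmul', smul_eq_mul]
    · rw [coe_equivWTwo, hg, Finset.smul_sum]
      simp
  have h₁₀ : differential R hN 0 ∘ₗ e₁.toLinearMap =
      e₀.toLinearMap ∘ₗ resolutionOne R M := by
    refine TensorProduct.AlgebraTensorModule.ext fun a p => ?_
    induction p using TensorProduct.induction_on with
    | zero => simp
    | tmul v m =>
      have hv : TensorAlgebra.ι k v ∈ tpow k V 1 := by rw [tpow_one]; exact ⟨v, rfl⟩
      rw [LinearMap.comp_apply, LinearMap.comp_apply, LinearEquiv.coe_coe, LinearEquiv.coe_coe,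
        resolutionOne_tmul, TrivialModule.mk_smul_eq_zero one_ne_zero hv,
        TensorProduct.tmul_zero, sub_zero, he₁,
        differential_tmul hN 0 a (fun _ : Unit => ⟨TensorAlgebra.ι k v, by
          rw [nu_zero, show nu N (0 + 1) = 1 from nu_one]; exact hv⟩)
          (fun _ => equivWZero R hN (ε m)) _ (by simp)]
      simp [e₀]
    | add x y hx hy => rw [TensorProduct.tmul_add, map_add, map_add, hx, hy]
  constructor
  · exact Function.Exact.of_ladder_linearEquiv_of_exact h₂₁ h₁₀
      (exact_resolutionTwo_resolutionOne hR)
  · have h := e₁.injective.comp (resolutionTwo_injective (M := M) hf hs hs' hR)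
    have h' : ⇑(differential R hN 1) ∘ ⇑e₂ = ⇑e₁ ∘ ⇑(resolutionTwo R M f) :=
      funext fun x => LinearMap.congr_fun h₂₁ x
    rw [← h'] at h
    exact (Function.Injective.of_comp_iff' _ e₂.bijective).1 h

/-- Degree `1` is exactness of the resolution of `k`. In degree `2`, `K_3 = 0` reduces the claim to
injectivity, and from degree `3` on the terms vanish. -/
theorem isNKoszul_of_hasLead (hf : HasLead b (TensorPower.toTensorAlgebra f) s)
    (hs : s ≠ 1) (hs' : s.toList.Nodup) (hR : R = Submodule.span k {f}) (hf0 : f ≠ 0)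
    (hN : 2 ≤ N) : IsNKoszul R hN := by
  have h := rel_mul_tpow_inf_tpow_mul_rel hf hs' hR one_ne_zero (by omega)
  obtain ⟨hex, hinj⟩ := differential_exact_and_injective hf hs hs' hR hf0 hN
  rintro (_ | _ | i)
  · exact hex
  · have := subsingleton_K hN h (i := 1 + 1 + 1) le_rfl
    intro x
    constructor
    · intro hx
      exact ⟨0, by rw [map_zero]; exact (hinj (hx.trans (map_zero _).symm)).symm⟩
    · rintro ⟨y, rfl⟩
      rw [Subsingleton.elim y 0, map_zero]
      exact map_zero _
  · have := subsingleton_K hN h (i := i + 1 + 1 + 1) (by omega)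
    intro x
    rw [Subsingleton.elim x 0]
    exact ⟨fun _ => ⟨0, map_zero _⟩, fun _ => map_zero _⟩

end Koszul

end NKoszul

end

/-! ### The main theorem -/

theorem mainTheorem5 {k : Type*} [Field k] [CharZero k]
    {V : Type*} [AddCommGroup V] [Module k V] [FiniteDimensional k V]
    (n N : ℕ) (hV : Module.finrank k V = n) (hn : 2 ≤ n) (hN : 2 ≤ N) (hNn : N ≤ n)
    (f : (⨂[k]^N) V) (hf : NKoszul.IsAntisymmetric f) (hf0 : f ≠ 0)
    (R : Submodule k ((⨂[k]^N) V)) (hR : R = Submodule.span k {f}) :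
    NKoszul.IsNKoszul R hN ∧
    NKoszul.globalDimension (NKoszul.Alg R) = 2 ∧
    ∀ m : ℕ, 1 ≤ m → m ≤ N - 1 →
      (NKoszul.rel R * NKoszul.tpow k V m) ⊓ (NKoszul.tpow k V m * NKoszul.rel R) = ⊥ := by
  let b := Module.finBasis k V
  have hF : TensorPower.toTensorAlgebra f ≠ 0 := fun h =>
    hf0 (NKoszul.toTensorAlgebra_injective k V N (by rw [h, map_zero]))
  obtain ⟨s, hs, hs0⟩ := NKoszul.exists_hasLead (b := b) hF
  have hnodup := hf.nodup b hs0
  have hs1 : s ≠ 1 := by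
    rintro rfl
    have := NKoszul.length_eq_of_mem_tpow b (NKoszul.toTensorAlgebra_mem_tpow f) hs0
    simp at this
    omega
  exact ⟨NKoszul.isNKoszul_of_hasLead hs hs1 hnodup hR hf0 hN,
    NKoszul.globalDimension_eq_two hs hs1 hnodup hR hN,
    fun m hm hmN => NKoszul.rel_mul_tpow_inf_tpow_mul_rel hs hnodup hR (by omega) (by omega)⟩
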